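/- **Conventions.** Let $\mathcal W_0$ be the set of all continuous, non-decreasing $\omega:[0,\infty)\to[0,\infty)$ with $\omega(t)=0$ for $0\le t\le 1$, $\lim_{t\to\infty}\omega(t)=\infty$, $\log t=o(\omega(t))$ as $t\to\infty$, and $y\mapsto\omega(e^y)$ convex on $\mathbb R$. Consider the conditions - $(\omega_1)$: $\exists L\ge1\ \forall t\ge0:\ \omega(2t)\le L(\omega(t)+1)$; - $(\omega_6)$: $\exists H\ge1\ \forall t\ge0:\ 2\omega(t)\le\omega(Ht)+H$. For $\omega\in\mathcal W_0$ put $\varphi^*_\omega(x)=\sup_{y\ge0}\{xy-\omega(e^y)\}$ and let $\mathcal M_\omega=\{\mathbf W^{(\ell)}:\ell>0\}$, $W^{(\ell)}_p=\exp(\frac1\ell\varphi^*_\omega(\ell p))$, $p\in\mathbb N$. For a positive sequence $\mathbf M$ with $M_0=1$ let $\omega_{\mathbf M}(t)=\sup_{p\in\mathbb N}\log(t^p/M_p)$. Let $\sigma\check\star\tau(t)=\inf_{s>0}\{\sigma(s)+\tau(t/s)\}$. Write $\sigma\sim\tau$ if $\sigma=O(\tau)$ and $\tau=O(\sigma)$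 at $\infty$. Products of sequences are point-wise; for matrices $\mathcal M=\{\mathbf M^{(\ell)}\}$, $\mathcal N=\{\mathbf N^{(\ell)}\}$ and a sequence $\mathbf N$ put $\mathcal M\cdot\mathcal N=\{\mathbf M^{(\ell)}\cdot\mathbf N^{(\ell)}:\ell>0\}$, $\mathcal M\cdot\mathbf N=\mathbf N\cdot\mathcal M=\{\mathbf M^{(\ell)}\cdot\mathbf N:\ell>0\}$. Write $\mathbf M\preceq\mathbf N$ if $\sup_{p\ge1}(M_p/N_p)^{1/p}<\infty$; write $\mathcal M\{\approx\}\mathcal N$ if for each $\alpha>0$ there is $\beta>0$ with $\mathbf M^{(\alpha)}\preceq\mathbf N^{(\beta)}$, and the same with $\mathcal M,\mathcal N$ exchanged; write $\mathcal M(\approx)\mathcal N$ if for each $\alpha>0$ there is $\beta>0$ with $\mathbf M^{(\beta)}\preceq\mathbf N^{(\alpha)}$, and the same with $\mathcal M,\mathcal N$ exchanged. The symbol $[\cdot]$ means: both for $\{\cdot\}$ (Roumieu) and for $(\cdot)$ (Beurling). **Spaces.** For a family $A$ of positive sequences $a$ the following spaces are built from step spaces, one for each $a\in A$, with the indicated norm;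 the Beurling space is the projective limit (intersection) and the Roumieu space the locally convex inductive limit (union) over $a\in A$. Norms: for $\mathcal B(U)$, $U\subseteq\mathbb R^d$ open, $\sup_{x\in U,\alpha}|\partial^\alpha f(x)|/a_{|\alpha|}$ on $C^\infty(U)$; for $\mathcal A(G)$, $G$ an open subset (e.g. a sector) of the Riemann surface of the logarithm, $\sup_{z\in G,p}|f^{(p)}(z)|/a_p$ on holomorphic functions; for $\mathcal S(\mathbb R^d)$, $\sup_{x,\alpha,k}(1+|x|)^k|\partial^\alpha f(x)|/a_{|\alpha|+k}$ on $C^\infty(\mathbb R^d)$; for $\Lambda$, $\sup_p|c_p|/a_p$ on $\mathbb C^{\mathbb N}$; for $\mathcal F$, $\sup_\alpha|c_\alpha|/a_{|\alpha|}$ on formal power series in $d$ variables, written either as $\sum c_\alpha x^\alpha$ or as $\sum c_\alpha x^\alpha/\alpha!$. Finally $\mathcal E(U)$ is the projective limit of the spaces $\mathcal B(V)$ over all open $V$ with compact closure $\overline V\subseteq U$. For $\mathfrak F\in\{\mathcal E,\mathcal B,\mathcal A,\mathcal S,\Lambda,\mathcal F\}$, $\mathfrak F_{[\omega]}$ is given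 by the sequences $p\mapsto\exp(\frac1\ell\varphi^*_\omega(\ell p))$, $\ell>0$, and $\mathfrak F_{[\mathcal M]}$ by the sequences $p\mapsto h^pM^{(\ell)}_p$, $\ell,h>0$. **Theorem 3.2.** Let $\sigma,\tau\in\mathcal W_0$ with associated matrices $\mathcal M_\sigma=\{\mathbf S^{(\ell)}:\ell>0\}$ and $\mathcal M_\tau=\{\mathbf T^{(\ell)}:\ell>0\}$. Then $\sigma\check\star\tau\in\mathcal W_0$; for all $\ell,\ell_1>0$ the functions $\omega_{\mathbf S^{(\ell)}}$, $\omega_{\mathbf T^{(\ell_1)}}$, $\omega_{\mathbf S^{(\ell)}\cdot\mathbf T^{(\ell_1)}}$ are finite and $\omega_{\mathbf S^{(\ell)}\cdot\mathbf T^{(\ell_1)}}\in\mathcal W_0$ (so all objects below are well defined); and: (i) For all $\ell,\ell_1>0$: $\omega_{\mathbf S^{(\ell)}\cdot\mathbf T^{(\ell_1)}}=\omega_{\mathbf S^{(\ell)}}\check\star\,\omega_{\mathbf T^{(\ell_1)}}\sim\sigma\check\star\tau$ on $[0,\infty)$; in particular $\omega_{\mathbf S^{(\ell)}\cdot\mathbf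 T^{(\ell)}}\sim\omega_{\mathbf S^{(j)}\cdot\mathbf T^{(j)}}$ for all $\ell,j>0$. (ii) For all $\ell>0$ and $p,q\in\mathbb N$: $S^{(\ell)}_{p+q}T^{(\ell)}_{p+q}\le S^{(2\ell)}_pT^{(2\ell)}_p\,S^{(2\ell)}_qT^{(2\ell)}_q$. Assume now in addition that $\sigma$ or $\tau$ satisfies $(\omega_1)$. (iii) $\forall h\ge1\ \exists d\ge1\ \forall\ell>0\ \exists D\ge1\ \forall p\in\mathbb N:\ h^pS^{(\ell)}_pT^{(\ell)}_p\le D\,S^{(d\ell)}_pT^{(d\ell)}_p$. (iv) For all $\ell,j>0$ and all six $\mathfrak F$, as locally convex vector spaces, $\mathfrak F_{[\mathcal M_\sigma\cdot\mathcal M_\tau]}=\mathfrak F_{[\omega_{\mathbf S^{(\ell)}\cdot\mathbf T^{(j)}}]}=\mathfrak F_{[\sigma\check\star\tau]}$. (v) If $\tau$ satisfies $(\omega_6)$, then for all $j>0$: $\mathcal M_\sigma\cdot\mathcal M_\tau[\approx]\mathcal M_\sigma\cdot\mathbf T^{(j)}$, and the spaces in (iv) also equal $\mathfrak F_{[\mathcal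 M_\sigma\cdot\mathbf T^{(j)}]}$. If $\sigma$ satisfies $(\omega_6)$, then for all $\ell>0$: $\mathcal M_\sigma\cdot\mathcal M_\tau[\approx]\mathbf S^{(\ell)}\cdot\mathcal M_\tau$, and the spaces in (iv) also equal $\mathfrak F_{[\mathbf S^{(\ell)}\cdot\mathcal M_\tau]}$. -/

import Mathlib

open Filter Topology Asymptotics Set

noncomputable section

namespace BMT

/-! ## Weight functions

A function on `[0, ∞)` is represented by a function `ℝ → ℝ` of which only the values on `[0, ∞)`
are ever used. -/

/-- The set `𝒲₀` of normalized weight functions in the sense of Braun, Meise and Taylor: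
`(ω₀)` (the first five fields), `(ω₃)` and `(ω₄)`. -/
structure IsWeight (ω : ℝ → ℝ) : Prop where
  continuousOn : ContinuousOn ω (Ici 0)
  monotoneOn : MonotoneOn ω (Ici 0)
  map_zero : ω 0 = 0
  tendsto : Tendsto ω atTop atTop
  normalized : ∀ t ∈ Icc (0 : ℝ) 1, ω t = 0
  omega3 : Real.log =o[atTop] ω
  omega4 : ConvexOn ℝ univ (fun y : ℝ => ω (Real.exp y))

/-- Condition `(ω₁)`. -/
def Omega1 (ω : ℝ → ℝ) : Prop :=
  ∃ L : ℝ, 1 ≤ L ∧ ∀ t : ℝ, 0 ≤ t → ω (2 * t) ≤ L * (ω t + 1)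

/-- Condition `(ω₆)`. -/
def Omega6 (ω : ℝ → ℝ) : Prop :=
  ∃ H : ℝ, 1 ≤ H ∧ ∀ t : ℝ, 0 ≤ t → 2 * ω t ≤ ω (H * t) + H

/-- The generalized lower Legendre conjugate
`(σ ⌣⋆ τ)(t) = inf {σ(s) + τ(t / s) : s > 0}`. -/
def lowerConj (σ τ : ℝ → ℝ) (t : ℝ) : ℝ :=
  ⨅ s : Ioi (0 : ℝ), (σ s + τ (t / s))

/-- The Legendre-Fenchel-Young conjugate of `φ_ω(y) = ω(e^y)`:
`φ*_ω(x) = sup {x y - ω(e^y) : y ≥ 0}`. -/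
def youngConj (ω : ℝ → ℝ) (x : ℝ) : ℝ :=
  ⨆ y : Ici (0 : ℝ), (x * y - ω (Real.exp y))

/-! ## Weight sequences and weight matrices

A weight matrix `{M^(ℓ) : ℓ > 0}` is represented by a map `ℝ → ℕ → ℝ` of which only the rows with
`ℓ > 0` are ever used. -/

/-- The set over which the supremum defining `ω_M(t)` is taken. -/
def assocSet (M : ℕ → ℝ) (t : ℝ) : Set ℝ :=
  range fun p : ℕ => Real.log (t ^ p / M p)

/-- The associated weight function `ω_M(t) = sup_p log (t^p / M_p)` of a sequence with `M_0 = 1`.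
For `t = 0` the term `p = 0` is `0` and the other terms are `-∞` in the usual convention and
`Real.log 0 = 0` here, so that the supremum is `0` in both readings. -/
def assocFun (M : ℕ → ℝ) (t : ℝ) : ℝ := sSup (assocSet M t)

/-- The weight matrix associated with `ω`: `W^(ℓ)_p = exp (φ*_ω(ℓ p) / ℓ)`. -/
def assocMatrix (ω : ℝ → ℝ) (ℓ : ℝ) (p : ℕ) : ℝ :=
  Real.exp (1 / ℓ * youngConj ω (ℓ * p))

/-- The product `𝓜 · 𝓝 = {M^(ℓ) · N^(ℓ) : ℓ > 0}` of two weight matrices. -/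
def matMul (M N : ℝ → ℕ → ℝ) : ℝ → ℕ → ℝ := fun ℓ => M ℓ * N ℓ

/-- The product `𝓜 · N = {M^(ℓ) · N : ℓ > 0}` of a weight matrix and a fixed sequence. -/
def matMulSeq (M : ℝ → ℕ → ℝ) (N : ℕ → ℝ) : ℝ → ℕ → ℝ := fun ℓ => M ℓ * N

/-- The product `N · 𝓜 = {N · M^(ℓ) : ℓ > 0}` of a fixed sequence and a weight matrix. -/
def seqMulMat (N : ℕ → ℝ) (M : ℝ → ℕ → ℝ) : ℝ → ℕ → ℝ := fun ℓ => N * M ℓ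

/-- `M ≼ N` for sequences: `sup_{p ≥ 1} (M_p / N_p)^(1/p) < ∞`. -/
def SeqLE (M N : ℕ → ℝ) : Prop :=
  BddAbove {r : ℝ | ∃ p : ℕ, 1 ≤ p ∧ r = (M p / N p) ^ (1 / (p : ℝ))}

/-- `𝓜 {≼} 𝓝`. -/
def RoumieuLE (M N : ℝ → ℕ → ℝ) : Prop :=
  ∀ α : ℝ, 0 < α → ∃ β : ℝ, 0 < β ∧ SeqLE (M α) (N β)

/-- `𝓜 (≼) 𝓝`. -/
def BeurlingLE (M N : ℝ → ℕ → ℝ) : Prop :=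
  ∀ α : ℝ, 0 < α → ∃ β : ℝ, 0 < β ∧ SeqLE (M β) (N α)

/-- `𝓜 [≈] 𝓝`: both R-equivalence `{≈}` and B-equivalence `(≈)`. -/
def MatEquiv (M N : ℝ → ℕ → ℝ) : Prop :=
  (RoumieuLE M N ∧ RoumieuLE N M) ∧ (BeurlingLE M N ∧ BeurlingLE N M)

/-- The estimate `M^(ℓ)_{p+q} ≤ M^(2ℓ)_p M^(2ℓ)_q` of moderate growth. -/
def ModerateGrowth (M : ℝ → ℕ → ℝ) : Prop :=
  ∀ ℓ : ℝ, 0 < ℓ → ∀ p q : ℕ, M ℓ (p + q) ≤ M (2 * ℓ) p * M (2 * ℓ) q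

/-- The estimate of absorption of exponential growth. -/
def ExpAbsorb (M : ℝ → ℕ → ℝ) : Prop :=
  ∀ h : ℝ, 1 ≤ h → ∃ d : ℝ, 1 ≤ d ∧ ∀ ℓ : ℝ, 0 < ℓ → ∃ D : ℝ, 1 ≤ D ∧
    ∀ p : ℕ, h ^ p * M ℓ p ≤ D * M (d * ℓ) p

/-! ## Families of sequences that define weighted spaces -/

/-- The sequences `p ↦ exp (φ*_ω(ℓ p) / ℓ)`, `ℓ > 0`, which define the spaces `𝔉_[ω]`. -/
def funFamily (ω : ℝ → ℝ) : Ioi (0 : ℝ) → ℕ → ℝ := fun ℓ => assocMatrix ω ℓ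

/-- The sequences `p ↦ h^p M^(ℓ)_p`, `ℓ, h > 0`, which define the spaces `𝔉_[𝓜]`. -/
def matFamily (M : ℝ → ℕ → ℝ) : Ioi (0 : ℝ) × Ioi (0 : ℝ) → ℕ → ℝ :=
  fun i p => (i.2 : ℝ) ^ p * M i.1 p

/-! ## Locally convex spaces inside a fixed vector space -/

/-- A linear subspace of `H` together with a topology on it. Equality of two such objects is
equality as topological vector spaces: the same elements and the same topology. -/
structure TopSubspace (H : Type) [AddCommGroup H] [Module ℂ H] where
  carrier : Submodule ℂ H
  top : TopologicalSpace carrier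

section Limits

variable {H : Type} [AddCommGroup H] [Module ℂ H]

/-- The projective limit (intersection) of a family of subspaces of `H`: the coarsest topology for
which all inclusions into the members of the family are continuous. -/
def projLim {ι : Type} (A : ι → TopSubspace H) : TopSubspace H where
  carrier := ⨅ i, (A i).carrier
  top := ⨅ i, TopologicalSpace.induced
    (Submodule.inclusion (iInf_le (fun i => (A i).carrier) i)) (A i).top

/-- `t` is a locally convex vector space topology. -/
def IsLCTopology (t : TopologicalSpace H) : Prop :=
  @IsTopologicalAddGroup H t _ ∧ @ContinuousSMul ℂ H _ _ t ∧ @LocallyConvexSpace ℝ H _ _ _ _ t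

/-- The locally convex inductive limit of a family of subspaces of `H`: their sum (which is the
union if the family is directed) with the finest locally convex topology for which all inclusions
of the members of the family are continuous. -/
def indLim {ι : Type} (A : ι → TopSubspace H) : TopSubspace H where
  carrier := ⨆ i, (A i).carrier
  top := sInf {t | IsLCTopology t ∧ ∀ i, @Continuous _ _ (A i).top t
    (Submodule.inclusion (le_iSup (fun i => (A i).carrier) i))}

/-- The subspace of all `x` in `H` whose images `R i x` belong to given spaces `A i`, with the
coarsest topology for which all `R i` are continuous. -/
def pullback {ι : Type} {K : ι → Type} [∀ i, AddCommGroup (K i)] [∀ i, Module ℂ (K i)]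
    (R : ∀ i, H →ₗ[ℂ] K i) (A : ∀ i, TopSubspace (K i)) : TopSubspace H where
  carrier := ⨅ i, (A i).carrier.comap (R i)
  top := ⨅ i, TopologicalSpace.induced
    (fun x => (⟨R i x, (Submodule.mem_iInf _).1 x.2 i⟩ : (A i).carrier)) (A i).top

end Limits

/-- A family of linear functionals `D t` on `H`, each with an order in `ℕ` (for instance the
evaluations of derivatives at points, with the order of differentiation). -/
structure Functionals (H : Type) [AddCommGroup H] [Module ℂ H] where
  T : Type
  D : T → H →ₗ[ℂ] ℂ
  ord : T → ℕ

section Weighted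

variable {H : Type} [AddCommGroup H] [Module ℂ H]

/-- The subspace `{f : sup_t |D_t f| / a_{ord t} < ∞}` for a sequence `a` of positive numbers. (The
absolute value of `a` is there only to have a seminorm below without a proof of positivity.) -/
def stepCarrier (Φ : Functionals H) (a : ℕ → ℝ) : Submodule ℂ H where
  carrier := {f | BddAbove (range fun t => ‖Φ.D t f‖ / |a (Φ.ord t)|)}
  zero_mem' := ⟨0, by rintro _ ⟨t, rfl⟩; simp⟩
  add_mem' := by
    rintro f g ⟨A, hA⟩ ⟨B, hB⟩
    refine ⟨A + B, ?_⟩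
    rintro _ ⟨t, rfl⟩
    refine le_trans ?_ (add_le_add (hA ⟨t, rfl⟩) (hB ⟨t, rfl⟩))
    simp only [map_add, ← add_div]
    gcongr
    exact norm_add_le _ _
  smul_mem' := by
    rintro c f ⟨A, hA⟩
    refine ⟨‖c‖ * A, ?_⟩
    rintro _ ⟨t, rfl⟩
    refine le_trans (le_of_eq ?_) (mul_le_mul_of_nonneg_left (hA ⟨t, rfl⟩) (norm_nonneg c))
    simp [mul_div_assoc]

/-- The norm `f ↦ sup_t |D_t f| / a_{ord t}`. -/
def stepSeminorm (Φ : Functionals H) (a : ℕ → ℝ) : Seminorm ℂ (stepCarrier Φ a) :=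
  Seminorm.of (fun f => ⨆ t, ‖Φ.D t f‖ / |a (Φ.ord t)|)
    (by
      intro f g
      refine Real.iSup_le (fun t => ?_) (add_nonneg (Real.iSup_nonneg fun t => by positivity)
        (Real.iSup_nonneg fun t => by positivity))
      refine le_trans ?_ (add_le_add (le_ciSup f.2 t) (le_ciSup g.2 t))
      simp only [Submodule.coe_add, map_add, ← add_div]
      gcongr
      exact norm_add_le _ _)
    (by
      intro c f
      rw [Real.mul_iSup_of_nonneg (norm_nonneg c)]
      simp [mul_div_assoc])

/-- The space `{f : sup_t |D_t f| / a_{ord t} < ∞}` with the topology given by this supremum as a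
norm. -/
def stepSpace (Φ : Functionals H) (a : ℕ → ℝ) : TopSubspace H where
  carrier := stepCarrier Φ a
  top := (stepSeminorm Φ a).toAddGroupSeminorm.toSeminormedAddCommGroup.toPseudoMetricSpace
    |>.toUniformSpace.toTopologicalSpace

/-- The two types of weighted spaces. -/
inductive SpaceKind
  | roumieu
  | beurling

/-- The weighted space given by a family `a` of sequences: of Roumieu type (inductive limit of the
step spaces) or of Beurling type (projective limit of the step spaces). -/
def weightedSpace (Φ : Functionals H) {ι : Type} (a : ι → ℕ → ℝ) : SpaceKind → TopSubspace H
  | .roumieu => indLim fun i => stepSpace Φ (a i)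
  | .beurling => projLim fun i => stepSpace Φ (a i)

end Weighted

/-! ## The six types of weighted spaces -/

/-- `ℝ^d` with the Euclidean norm. -/
abbrev Euc (d : ℕ) : Type := EuclideanSpace ℝ (Fin d)

/-- The space `C^∞(U)` of smooth functions `U → ℂ`, extended by `0` outside of `U`. -/
def Smooth {d : ℕ} (U : TopologicalSpace.Opens (Euc d)) : Submodule ℂ (Euc d → ℂ) where
  carrier := {f | ContDiffOn ℝ (⊤ : ℕ∞) f U ∧ ∀ x ∉ U, f x = 0}
  zero_mem' := ⟨contDiffOn_const, fun _ _ => rfl⟩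
  add_mem' := fun hf hg => ⟨hf.1.add hg.1, fun x hx => by simp [hf.2 x hx, hg.2 x hx]⟩
  smul_mem' := fun c f hf => ⟨hf.1.const_smul c, fun x hx => by simp [hf.2 x hx]⟩

theorem smooth_contDiffAt {d : ℕ} {U : TopologicalSpace.Opens (Euc d)} (f : Smooth U) (x : U)
    (n : ℕ) : ContDiffAt ℝ n (f : Euc d → ℂ) x :=
  (f.2.1.contDiffAt (U.isOpen.mem_nhds x.2)).of_le (by exact_mod_cast le_top)

/-- The partial derivative `∂_{v 0} ⋯ ∂_{v (n-1)} f(x)` of order `n`. When `v` runs through all maps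
`Fin n → Fin d`, these are all `∂^α f(x)` with `|α| = n`. -/
def partialAt {d : ℕ} (U : TopologicalSpace.Opens (Euc d)) (n : ℕ) (v : Fin n → Fin d) (x : U) :
    Smooth U →ₗ[ℂ] ℂ where
  toFun f := iteratedFDeriv ℝ n (f : Euc d → ℂ) x fun i => EuclideanSpace.single (v i) 1
  map_add' f g := by
    have h := iteratedFDeriv_add_apply (smooth_contDiffAt f x n) (smooth_contDiffAt g x n)
    simpa using congrArg (fun L => L fun i => EuclideanSpace.single (v i) (1 : ℝ)) h
  map_smul' c f := by
    have h := iteratedFDeriv_const_smul_apply (a := c) (smooth_contDiffAt f x n)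
    simpa using congrArg (fun L => L fun i => EuclideanSpace.single (v i) (1 : ℝ)) h

/-- All `∂^α f(x)` with `x ∈ U`. -/
def partials {d : ℕ} (U : TopologicalSpace.Opens (Euc d)) : Functionals (Smooth U) where
  T := (Σ n : ℕ, (Fin n → Fin d)) × U
  D := fun t => partialAt U t.1.1 t.1.2 t.2
  ord := fun t => t.1.1

/-- The globally defined ultradifferentiable functions `𝓑_[a](U)`, with the norms
`sup {|∂^α f(x)| / a_{|α|} : x ∈ U, α}`. -/
def spaceB {d : ℕ} (U : TopologicalSpace.Opens (Euc d)) {ι : Type} (a : ι → ℕ → ℝ)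
    (k : SpaceKind) : TopSubspace (Smooth U) :=
  weightedSpace (partials U) a k

/-- The restriction `C^∞(U) → C^∞(V)` for `V ⊆ U`. -/
def restrict {d : ℕ} {U V : TopologicalSpace.Opens (Euc d)} (h : V ≤ U) :
    Smooth U →ₗ[ℂ] Smooth V where
  toFun f := ⟨(V : Set (Euc d)).indicator f,
    (f.2.1.mono h).congr fun _ hx => indicator_of_mem hx _,
    fun _ hx => indicator_of_notMem hx _⟩
  map_add' _ _ := Subtype.ext (indicator_add _ _ _)
  map_smul' c f := Subtype.ext (indicator_const_smul (V : Set (Euc d)) c (f : Euc d → ℂ))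

/-- The open sets `V` whose closure is compact and contained in `U`. -/
def RelCompact {d : ℕ} (U : TopologicalSpace.Opens (Euc d)) : Type :=
  {V : TopologicalSpace.Opens (Euc d) //
    IsCompact (closure (V : Set (Euc d))) ∧ closure (V : Set (Euc d)) ⊆ U}

/-- The ultradifferentiable functions `𝓔_[a](U)`: the estimates hold locally, and the topology is
the projective limit, over all relatively compact open `V` with closure in `U`, of the spaces with
estimates on `V`. -/
def spaceE {d : ℕ} (U : TopologicalSpace.Opens (Euc d)) {ι : Type} (a : ι → ℕ → ℝ)
    (k : SpaceKind) : TopSubspace (Smooth U) :=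
  pullback (ι := RelCompact U) (K := fun V => Smooth V.1)
    (fun V => restrict (fun _ hx => V.2.2 (subset_closure hx)))
    (fun V => spaceB V.1 a k)

/-- The holomorphic functions on an open subset `G` of the Riemann surface of the logarithm. This
surface is represented by `ℂ`, with `w` standing for the point `z = e^w`; the (unbounded) sector
with bisecting direction `θ` and opening `π γ` is `{w : |Im w - θ| < π γ / 2}`. Functions are
extended by `0` outside of `G`. -/
def Holo (G : TopologicalSpace.Opens ℂ) : Submodule ℂ (ℂ → ℂ) where
  carrier := {f | DifferentiableOn ℂ f G ∧ ∀ w ∉ G, f w = 0}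
  zero_mem' := ⟨differentiableOn_const 0, fun _ _ => rfl⟩
  add_mem' := fun hf hg => ⟨hf.1.add hg.1, fun x hx => by simp [hf.2 x hx, hg.2 x hx]⟩
  smul_mem' := fun c f hf => ⟨hf.1.const_smul c, fun x hx => by simp [hf.2 x hx]⟩

theorem holo_differentiableAt {G : TopologicalSpace.Opens ℂ} (f : Holo G) {w : ℂ} (hw : w ∈ G) :
    DifferentiableAt ℂ (f : ℂ → ℂ) w :=
  f.2.1.differentiableAt (G.isOpen.mem_nhds hw)

/-- The derivative `d/dz` in the coordinate `w` with `z = e^w`, that is `e^{-w} d/dw`. -/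
def holoDeriv (G : TopologicalSpace.Opens ℂ) : Module.End ℂ (Holo G) where
  toFun f := ⟨(G : Set ℂ).indicator fun w => Complex.exp (-w) * deriv f w, by
    refine ⟨DifferentiableOn.congr (f := fun w => Complex.exp (-w) * deriv f w) ?_
      fun w hw => indicator_of_mem hw _, fun w hw => indicator_of_notMem hw _⟩
    exact (Complex.differentiable_exp.comp differentiable_neg).differentiableOn.mul
      (f.2.1.deriv G.isOpen)⟩
  map_add' f g := by
    refine Subtype.ext (funext fun w => ?_)
    by_cases hw : w ∈ (G : Set ℂ)
    · have h := deriv_add (holo_differentiableAt f hw) (holo_differentiableAt g hw)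
      simp [hw, h, mul_add]
    · simp [hw]
  map_smul' c f := by
    refine Subtype.ext (funext fun w => ?_)
    by_cases hw : w ∈ (G : Set ℂ)
    · have h := deriv_const_smul c (holo_differentiableAt f hw)
      simp [hw, h, mul_left_comm]
    · simp [hw]

/-- All derivatives `f^(p)(z)` with `z ∈ G`. -/
def holoDerivs (G : TopologicalSpace.Opens ℂ) : Functionals (Holo G) where
  T := ℕ × G
  D := fun t => (LinearMap.proj (t.2 : ℂ)).comp ((Holo G).subtype.comp (holoDeriv G ^ t.1))
  ord := fun t => t.1

/-- The ultraholomorphic functions `𝓐_[a](G)`, with the norms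
`sup {|f^(p)(z)| / a_p : z ∈ G, p}`. -/
def spaceA (G : TopologicalSpace.Opens ℂ) {ι : Type} (a : ι → ℕ → ℝ) (k : SpaceKind) :
    TopSubspace (Holo G) :=
  weightedSpace (holoDerivs G) a k

/-- All `(1 + |x|)^k ∂^α f(x)` with `x ∈ ℝ^d` and `k ∈ ℕ`, of order `|α| + k`. -/
def gelfandShilov (d : ℕ) : Functionals (Smooth (⊤ : TopologicalSpace.Opens (Euc d))) where
  T := ((Σ n : ℕ, (Fin n → Fin d)) × (⊤ : TopologicalSpace.Opens (Euc d))) × ℕ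
  D := fun t => (((1 + ‖(t.1.2 : Euc d)‖) ^ t.2 : ℝ) : ℂ) • partialAt ⊤ t.1.1.1 t.1.1.2 t.1.2
  ord := fun t => t.1.1.1 + t.2

/-- The Gelfand-Shilov type spaces `𝓢_[a](ℝ^d)`, with the norms
`sup {(1 + |x|)^k |∂^α f(x)| / a_{|α| + k} : x ∈ ℝ^d, α, k}`. -/
def spaceS (d : ℕ) {ι : Type} (a : ι → ℕ → ℝ) (k : SpaceKind) :
    TopSubspace (Smooth (⊤ : TopologicalSpace.Opens (Euc d))) :=
  weightedSpace (gelfandShilov d) a k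

/-- All members of a sequence of complex numbers. -/
def seqTerms : Functionals (ℕ → ℂ) where
  T := ℕ
  D := fun p => LinearMap.proj p
  ord := fun p => p

/-- The weighted spaces of sequences `Λ_[a]`, with the norms `sup_p |c_p| / a_p`. -/
def spaceL {ι : Type} (a : ι → ℕ → ℝ) (k : SpaceKind) : TopSubspace (ℕ → ℂ) :=
  weightedSpace seqTerms a k

/-- The two usual ways of naming the coefficients `c_α` of a formal power series. -/
inductive CoeffConvention
  /-- the series is `∑ c_α x^α` -/
  | ordinary
  /-- the series is `∑ c_α x^α / α!` -/
  | taylor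

/-- All coefficients `c_α` of a formal power series, of order `|α|`. -/
def coeffs (d : ℕ) (c : CoeffConvention) : Functionals (MvPowerSeries (Fin d) ℂ) where
  T := Fin d →₀ ℕ
  D := fun α => match c with
    | .ordinary => MvPowerSeries.coeff α
    | .taylor => ((∏ i, (α i).factorial : ℕ) : ℂ) • MvPowerSeries.coeff α
  ord := fun α => ∑ i, α i

/-- The weighted formal power series `𝓕_[a]` in `d` variables with complex coefficients, with the
norms `sup_α |c_α| / a_{|α|}`. -/
def spaceF (d : ℕ) (c : CoeffConvention) {ι : Type} (a : ι → ℕ → ℝ) (k : SpaceKind) :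
    TopSubspace (MvPowerSeries (Fin d) ℂ) :=
  weightedSpace (coeffs d c) a k

/-- The families `a` and `b` define the same locally convex vector spaces `𝔉_[a] = 𝔉_[b]`, of
Roumieu type and of Beurling type, for each of the six types `𝔉 = 𝓔, 𝓑, 𝓐, 𝓢, Λ, 𝓕` and over all
admissible domains. -/
def SameSpaces {ι κ : Type} (a : ι → ℕ → ℝ) (b : κ → ℕ → ℝ) : Prop :=
  ∀ k : SpaceKind,
    (∀ (d : ℕ) (U : TopologicalSpace.Opens (Euc d)), spaceE U a k = spaceE U b k) ∧
    (∀ (d : ℕ) (U : TopologicalSpace.Opens (Euc d)), spaceB U a k = spaceB U b k) ∧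
    (∀ G : TopologicalSpace.Opens ℂ, spaceA G a k = spaceA G b k) ∧
    (∀ d : ℕ, spaceS d a k = spaceS d b k) ∧
    spaceL a k = spaceL b k ∧
    (∀ (d : ℕ) (c : CoeffConvention), spaceF d c a k = spaceF d c b k)

end BMT

end

open BMT

namespace BMT

/-! ## Weight functions and their Young conjugates -/

namespace IsWeight

variable {ω : ℝ → ℝ}

/-! In the coordinate `t = e^y` the lower Legendre conjugate is the infimal convolution of `σ(e^y)`
and `τ(e^y)`, and Young conjugation turns infimal convolution into a sum (`youngConj_lowerConj`).
After exponentiation, `S^(ℓ) · T^(ℓ)` is exactly the row `ℓ` of the matrix of the single weight `σ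
⌣⋆ τ` (`assocMatrix_lowerConj`). Moderate growth, absorption of exponentials and equality of spaces
thus reduce to one weight, which inherits `(ω₁)` from either factor.

For rows with different parameters, `assocFun_mul` is a discrete counterpart: by logarithmic
convexity, an index that is optimal for the product at `x` is optimal for the two factors at
suitable points `y` and `x - y`. Moreover `ω_{W^(ℓ)}` is comparable to `ω`: one bound is Young's
inequality, the other rounds a supporting slope to a multiple of `ℓ` and absorbs the error by `log t
= o(ω(t))`.

A bound `a ≤ C b` between sequences gives a continuous inclusion of step spaces, so only domination
between families matters. A comparison of weights rescales `ℓ`; `(ω₁)` trades `h^p` for a larger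
`ℓ`; `(ω₆)` trades a larger `ℓ` for `h^p`, so that all rows are equivalent and one factor can be
frozen. -/

theorem nonneg (h : IsWeight ω) {t : ℝ} (ht : 0 ≤ t) : 0 ≤ ω t := by
  rw [← h.map_zero]
  exact h.monotoneOn self_mem_Ici ht ht

theorem exp_of_nonpos (h : IsWeight ω) {y : ℝ} (hy : y ≤ 0) : ω (Real.exp y) = 0 :=
  h.normalized _ ⟨(Real.exp_pos y).le, Real.exp_le_one_iff.2 hy⟩

theorem exp_nonneg (h : IsWeight ω) (y : ℝ) : 0 ≤ ω (Real.exp y) :=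
  h.nonneg (Real.exp_pos y).le

theorem exp_mono (h : IsWeight ω) {y z : ℝ} (hyz : y ≤ z) : ω (Real.exp y) ≤ ω (Real.exp z) :=
  h.monotoneOn (Real.exp_pos y).le (Real.exp_pos z).le (Real.exp_le_exp.2 hyz)

/-- A weight function grows faster than every multiple of the logarithm. -/
theorem exists_linear_le (h : IsWeight ω) {C : ℝ} (hC : 0 ≤ C) :
    ∃ D : ℝ, 0 ≤ D ∧ ∀ y : ℝ, C * y ≤ ω (Real.exp y) + D := by
  have h3 := (isLittleO_iff.1 h.omega3) (show (0 : ℝ) < 1 / (C + 1) by positivity)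
  obtain ⟨Y, hY⟩ := eventually_atTop.1 (Real.tendsto_exp_atTop.eventually h3)
  -- Up to `|Y|` the line is at most `C |Y|` and `ω ≥ 0`; beyond it the little-o bound applies.
  refine ⟨C * |Y|, by positivity, fun y => ?_⟩
  rcases le_total y |Y| with hy | hy
  · have := mul_le_mul_of_nonneg_left hy hC
    linarith [h.exp_nonneg y]
  · have h1 := hY y ((le_abs_self Y).trans hy)
    have hy0 : 0 ≤ y := (abs_nonneg Y).trans hy
    rw [Real.log_exp, Real.norm_of_nonneg hy0, Real.norm_of_nonneg (h.exp_nonneg y),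
      one_div_mul_eq_div, le_div_iff₀ (by positivity)] at h1
    have : 0 ≤ C * |Y| := by positivity
    nlinarith

/-- The defining properties of a weight function in logarithmic coordinates. -/
theorem of_growth (mono : MonotoneOn ω (Ici 0)) (zero : ∀ t ∈ Icc (0 : ℝ) 1, ω t = 0)
    (growth : ∀ C : ℝ, 0 ≤ C → ∃ D : ℝ, ∀ y : ℝ, 0 ≤ y → C * y ≤ ω (Real.exp y) + D)
    (conv : ConvexOn ℝ univ fun y : ℝ => ω (Real.exp y)) : IsWeight ω where
  continuousOn := by
    have hc : Continuous fun y : ℝ => ω (Real.exp y) :=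
      continuousOn_univ.1 (conv.continuousOn isOpen_univ)
    -- Convexity gives continuity only in `y`, which misses `t = 0`. As `ω` vanishes on `[0, 1]`,
    -- replacing `t` by `max t 1` does not change its value.
    have hl : Continuous fun t : ℝ => Real.log (max t 1) :=
      (continuous_id.max continuous_const).log fun t =>
        (zero_lt_one.trans_le (le_max_right t 1)).ne'
    refine (hc.comp hl).continuousOn.congr fun t ht => ?_
    simp only [Function.comp_apply]
    rw [Real.exp_log (zero_lt_one.trans_le (le_max_right t 1))]
    rcases le_total t 1 with h | h
    · rw [max_eq_right h, zero t ⟨ht, h⟩, zero 1 (by simp)]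
    · rw [max_eq_left h]
  monotoneOn := mono
  map_zero := zero 0 (by simp)
  tendsto := by
    obtain ⟨D, hD⟩ := growth 1 zero_le_one
    refine tendsto_atTop_mono' atTop (f₁ := fun t => Real.log t + -D) ?_
      (tendsto_atTop_add_const_right _ _ Real.tendsto_log_atTop)
    filter_upwards [eventually_ge_atTop 1] with t ht
    have := hD (Real.log t) (Real.log_nonneg ht)
    rw [Real.exp_log (by linarith)] at this
    linarith
  normalized := zero
  omega3 := by
    refine isLittleO_iff.2 fun c hc => ?_
    -- The slope is twice what is needed; the surplus `log t` absorbs `c D` for large `t`.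
    obtain ⟨D, hD⟩ := growth (2 / c) (by positivity)
    filter_upwards [eventually_ge_atTop 1,
      Real.tendsto_log_atTop.eventually_ge_atTop (c * D)] with t ht htD
    have h1 := hD (Real.log t) (Real.log_nonneg ht)
    rw [Real.exp_log (by linarith), div_mul_eq_mul_div, div_le_iff₀ hc] at h1
    rw [Real.norm_of_nonneg (Real.log_nonneg ht)]
    have h2 : c * ω t ≤ c * ‖ω t‖ := mul_le_mul_of_nonneg_left (le_abs_self _) hc.le
    linarith
  omega4 := conv

/-- Superlogarithmic growth makes the supremum in `youngConj` a true one rather than the default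
value of an unbounded `⨆`. -/
theorem bddAbove_young (h : IsWeight ω) (x : ℝ) :
    BddAbove (range fun y : Ici (0 : ℝ) => x * y - ω (Real.exp y)) := by
  obtain ⟨D, hD0, hD⟩ := h.exists_linear_le (abs_nonneg x)
  refine ⟨D, ?_⟩
  rintro _ ⟨⟨y, hy⟩, rfl⟩
  have := mul_le_mul_of_nonneg_right (le_abs_self x) (show 0 ≤ y from hy)
  have := hD y
  simp only
  linarith

/-- Young's inequality. -/
theorem le_youngConj (h : IsWeight ω) {x : ℝ} (hx : 0 ≤ x) (y : ℝ) :
    x * y - ω (Real.exp y) ≤ youngConj ω x := by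
  rcases le_total 0 y with hy | hy
  · exact le_ciSup (h.bddAbove_young x) ⟨y, hy⟩
  -- The supremum runs over `y ≥ 0` only. For `y ≤ 0` the term is at most `0`, the value at `y = 0`;
  -- this frees later shifts of `y` from sign conditions.
  · have h0 := le_ciSup (h.bddAbove_young x) ⟨0, self_mem_Ici⟩
    simp only [mul_zero, h.exp_of_nonpos le_rfl, sub_zero] at h0
    rw [h.exp_of_nonpos hy]
    have := mul_nonpos_of_nonneg_of_nonpos hx hy
    unfold youngConj
    linarith

theorem youngConj_nonneg (h : IsWeight ω) {x : ℝ} (hx : 0 ≤ x) : 0 ≤ youngConj ω x := by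
  have := h.le_youngConj hx 0
  rwa [h.exp_of_nonpos le_rfl, mul_zero, sub_zero] at this

end IsWeight

theorem youngConj_le {ω : ℝ → ℝ} {x c : ℝ}
    (h : ∀ y : ℝ, 0 ≤ y → x * y - ω (Real.exp y) ≤ c) : youngConj ω x ≤ c :=
  ciSup_le fun y => h y y.2

theorem IsWeight.youngConj_mono {ω : ℝ → ℝ} (h : IsWeight ω) {x z : ℝ} (hx : 0 ≤ x)
    (hxz : x ≤ z) : youngConj ω x ≤ youngConj ω z :=
  youngConj_le fun y hy => by
    have := h.le_youngConj (hx.trans hxz) y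
    have := mul_le_mul_of_nonneg_right hxz hy
    linarith

/-- A convex function on the line has a supporting line at each point. -/
theorem exists_supporting_line {f : ℝ → ℝ} (hf : ConvexOn ℝ univ f) (y : ℝ) :
    ∃ x : ℝ, ∀ z : ℝ, f y + x * (z - y) ≤ f z := by
  have hy : y ∈ interior (univ : Set ℝ) := by simp
  refine ⟨derivWithin f (Ioi y) y, fun z => ?_⟩
  rcases lt_trichotomy z y with hz | rfl | hz
  · have h1 := (hf.slope_le_leftDeriv_of_mem_interior (mem_univ z) hy hz).trans
      (hf.leftDeriv_le_rightDeriv_of_mem_interior hy)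
    rw [slope_def_field, div_le_iff₀ (by linarith)] at h1
    linarith
  · simp
  · have h1 := hf.rightDeriv_le_slope_of_mem_interior hy (mem_univ z) hz
    rw [slope_def_field, le_div_iff₀ (by linarith)] at h1
    linarith

/-- The equality case of Young's inequality. -/
theorem IsWeight.exists_eq_young {ω : ℝ → ℝ} (h : IsWeight ω) (y : ℝ) :
    ∃ x : ℝ, 0 ≤ x ∧ youngConj ω x ≤ x * y - ω (Real.exp y) := by
  obtain ⟨x, hx⟩ := exists_supporting_line h.omega4 y
  refine ⟨x, ?_, youngConj_le fun z _ => by linarith [hx z]⟩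
  -- A supporting slope of a non-decreasing function is nonnegative.
  have h1 := hx (y - 1)
  have h2 := h.exp_mono (show y - 1 ≤ y by linarith)
  linarith

/-! ## The lower Legendre conjugate -/

section LowerConj

variable {σ τ : ℝ → ℝ}

theorem bddBelow_lowerConj (hσ : ∀ t, 0 ≤ t → 0 ≤ σ t) (hτ : ∀ t, 0 ≤ t → 0 ≤ τ t) {t : ℝ}
    (ht : 0 ≤ t) : BddBelow (range fun s : Ioi (0 : ℝ) => σ s + τ (t / s)) := by
  refine ⟨0, ?_⟩
  rintro _ ⟨⟨s, hs⟩, rfl⟩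
  exact add_nonneg (hσ s (le_of_lt hs)) (hτ _ (div_nonneg ht (le_of_lt hs)))

theorem lowerConj_le (hσ : ∀ t, 0 ≤ t → 0 ≤ σ t) (hτ : ∀ t, 0 ≤ t → 0 ≤ τ t) {s t : ℝ}
    (hs : 0 < s) (ht : 0 ≤ t) : lowerConj σ τ t ≤ σ s + τ (t / s) :=
  ciInf_le (bddBelow_lowerConj hσ hτ ht) ⟨s, hs⟩

theorem le_lowerConj {t c : ℝ} (h : ∀ s : ℝ, 0 < s → c ≤ σ s + τ (t / s)) :
    c ≤ lowerConj σ τ t :=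
  haveI : Nonempty (Ioi (0 : ℝ)) := ⟨⟨1, one_pos (α := ℝ)⟩⟩
  le_ciInf fun s => h s s.2

theorem exists_lt_of_lowerConj_lt {t c : ℝ} (h : lowerConj σ τ t < c) :
    ∃ s : ℝ, 0 < s ∧ σ s + τ (t / s) < c := by
  have : Nonempty (Ioi (0 : ℝ)) := ⟨⟨1, one_pos (α := ℝ)⟩⟩
  obtain ⟨s, hs⟩ := exists_lt_of_ciInf_lt h
  exact ⟨s, s.2, hs⟩

/-- In logarithmic coordinates the lower Legendre conjugate is an infimal convolution. -/
theorem lowerConj_exp_add_le (hσ : ∀ t, 0 ≤ t → 0 ≤ σ t) (hτ : ∀ t, 0 ≤ t → 0 ≤ τ t) (y z : ℝ) :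
    lowerConj σ τ (Real.exp (y + z)) ≤ σ (Real.exp y) + τ (Real.exp z) := by
  have := lowerConj_le hσ hτ (Real.exp_pos y) (Real.exp_pos (y + z)).le
  rwa [← Real.exp_sub, add_sub_cancel_left] at this

theorem le_lowerConj_exp {y c : ℝ}
    (h : ∀ u : ℝ, c ≤ σ (Real.exp u) + τ (Real.exp (y - u))) :
    c ≤ lowerConj σ τ (Real.exp y) :=
  le_lowerConj fun s hs => by simpa [Real.exp_sub, Real.exp_log hs] using h (Real.log s)

theorem exists_lt_of_lowerConj_exp_lt {y c : ℝ} (h : lowerConj σ τ (Real.exp y) < c) :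
    ∃ u : ℝ, σ (Real.exp u) + τ (Real.exp (y - u)) < c := by
  obtain ⟨s, hs, h⟩ := exists_lt_of_lowerConj_lt h
  exact ⟨Real.log s, by simpa [Real.exp_sub, Real.exp_log hs] using h⟩

/-- Substitute `s ↦ t / s`, which requires `t ≠ 0`. -/
theorem lowerConj_comm (σ τ : ℝ → ℝ) {t : ℝ} (ht : 0 < t)
    (hσ : ∀ t, 0 ≤ t → 0 ≤ σ t) (hτ : ∀ t, 0 ≤ t → 0 ≤ τ t) :
    lowerConj σ τ t = lowerConj τ σ t := by
  apply le_antisymm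
  · refine le_lowerConj fun s hs => ?_
    have := lowerConj_le hσ hτ (div_pos ht hs) ht.le
    rwa [div_div_cancel₀ ht.ne', add_comm] at this
  · refine le_lowerConj fun s hs => ?_
    have := lowerConj_le hτ hσ (div_pos ht hs) ht.le
    rwa [div_div_cancel₀ ht.ne', add_comm] at this

variable (hσ : IsWeight σ) (hτ : IsWeight τ)
include hσ hτ

theorem IsWeight.lowerConj : IsWeight (lowerConj σ τ) := by
  have n1 := fun t => hσ.nonneg (t := t)
  have n2 := fun t => hτ.nonneg (t := t)
  refine IsWeight.of_growth ?_ ?_ ?_ ?_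
  · intro t ht u hu htu
    refine le_lowerConj fun s hs => (lowerConj_le n1 n2 hs ht).trans ?_
    gcongr
    exact hτ.monotoneOn (div_nonneg ht hs.le) (div_nonneg hu hs.le) (by gcongr)
  · intro t ht
    apply le_antisymm
    · have := lowerConj_le n1 n2 one_pos ht.1
      rwa [div_one, hσ.normalized 1 (by simp), hτ.normalized t ht, add_zero] at this
    · exact le_lowerConj fun s hs => add_nonneg (n1 s hs.le) (n2 _ (div_nonneg ht.1 hs.le))
  · intro C hC
    obtain ⟨D, -, hD⟩ := hσ.exists_linear_le hC
    obtain ⟨E, -, hE⟩ := hτ.exists_linear_le hC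
    refine ⟨D + E, fun y _ => ?_⟩
    -- The two linear minorants have the same slope `C`, so their sum at `u` and `y - u` does not
    -- depend on `u`.
    rw [← sub_le_iff_le_add]
    exact le_lowerConj_exp fun u => by linarith [hD u, hE (y - u)]
  -- Convex combinations of near-minimizers compete at the combined point; `ε` avoids proving that
  -- the infimum is attained.
  · refine ⟨convex_univ, fun y _ z _ a b ha hb hab => le_of_forall_pos_le_add fun ε hε => ?_⟩
    obtain ⟨u, hu⟩ := exists_lt_of_lowerConj_exp_lt (lt_add_of_pos_right
      (BMT.lowerConj σ τ (Real.exp y)) hε)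
    obtain ⟨v, hv⟩ := exists_lt_of_lowerConj_exp_lt (lt_add_of_pos_right
      (BMT.lowerConj σ τ (Real.exp z)) hε)
    have h1 := lowerConj_exp_add_le n1 n2 (a • u + b • v) (a • (y - u) + b • (z - v))
    have h2 := hσ.omega4.2 (mem_univ u) (mem_univ v) ha hb hab
    have h3 := hτ.omega4.2 (mem_univ (y - u)) (mem_univ (z - v)) ha hb hab
    have e : a • u + b • v + (a • (y - u) + b • (z - v)) = a • y + b • z := by
      simp only [smul_eq_mul]; ring
    rw [e] at h1
    simp only [smul_eq_mul] at *
    have h4 := mul_le_mul_of_nonneg_left hu.le ha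
    have h5 := mul_le_mul_of_nonneg_left hv.le hb
    have h6 : a * ε + b * ε = ε := by rw [← add_mul, hab, one_mul]
    linarith

/-- The Young conjugate of an infimal convolution is the sum of the Young conjugates. -/
theorem youngConj_lowerConj {x : ℝ} (hx : 0 ≤ x) :
    youngConj (lowerConj σ τ) x = youngConj σ x + youngConj τ x := by
  have n1 := fun t => hσ.nonneg (t := t)
  have n2 := fun t => hτ.nonneg (t := t)
  apply le_antisymm
  · refine youngConj_le fun y _ => ?_
    rw [sub_le_comm]
    refine le_lowerConj_exp fun u => ?_
    linarith [hσ.le_youngConj hx u, hτ.le_youngConj hx (y - u)]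
  -- The two suprema are taken one at a time; arbitrary `y` and `z` are tested together at `y + z`.
  · rw [← le_sub_iff_add_le]
    refine youngConj_le fun y _ => ?_
    rw [le_sub_comm]
    refine youngConj_le fun z _ => ?_
    linarith [(hσ.lowerConj hτ).le_youngConj hx (y + z), lowerConj_exp_add_le n1 n2 y z]

theorem assocMatrix_lowerConj {ℓ : ℝ} (hℓ : 0 < ℓ) :
    assocMatrix (lowerConj σ τ) ℓ = assocMatrix σ ℓ * assocMatrix τ ℓ := by
  ext p
  simp only [assocMatrix, Pi.mul_apply, ← Real.exp_add,
    youngConj_lowerConj hσ hτ (show 0 ≤ ℓ * p by positivity), mul_add]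

/-- Putting the factor `2` into `s` leaves `t / s` unchanged, so `τ` needs no doubling condition and
`L ≥ 1` covers its term. -/
theorem omega1_lowerConj_left (h1 : Omega1 σ) : Omega1 (lowerConj σ τ) := by
  have n1 := fun t => hσ.nonneg (t := t)
  have n2 := fun t => hτ.nonneg (t := t)
  obtain ⟨L, hL, h⟩ := h1
  have hL0 : 0 < L := by linarith
  refine ⟨L, hL, fun t ht => ?_⟩
  rw [← div_le_iff₀' hL0, ← sub_le_iff_le_add]
  refine le_lowerConj fun s hs => ?_
  rw [sub_le_iff_le_add, div_le_iff₀' hL0]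
  have h2 := lowerConj_le n1 n2 (show 0 < 2 * s by positivity) (show 0 ≤ 2 * t by positivity)
  rw [mul_div_mul_left _ _ two_ne_zero] at h2
  have h3 := h s hs.le
  have h4 := n2 (t / s) (div_nonneg ht hs.le)
  nlinarith

theorem omega1_lowerConj (h : Omega1 σ ∨ Omega1 τ) : Omega1 (lowerConj σ τ) := by
  rcases h with h | h
  · exact omega1_lowerConj_left hσ hτ h
  · obtain ⟨L, hL, h1⟩ := omega1_lowerConj_left hτ hσ h
    refine ⟨L, hL, fun t ht => ?_⟩
    rcases ht.eq_or_lt with rfl | ht'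
    · have := (hσ.lowerConj hτ).map_zero
      simp only [mul_zero, this]
      linarith
    · have n1 := fun t => hσ.nonneg (t := t)
      have n2 := fun t => hτ.nonneg (t := t)
      rw [lowerConj_comm σ τ ht' n1 n2,
        lowerConj_comm σ τ (by positivity : 0 < 2 * t) n1 n2]
      exact h1 t ht

end LowerConj

/-! ## Continuous inclusions of weighted spaces -/

namespace TopSubspace

variable {H : Type} [AddCommGroup H] [Module ℂ H]

/-- `A` is contained in `B`, with a continuous inclusion. -/
def ContIncl (A B : TopSubspace H) : Prop :=
  ∃ h : A.carrier ≤ B.carrier, @Continuous _ _ A.top B.top (Submodule.inclusion h)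

theorem ContIncl.antisymm {A B : TopSubspace H} (h : A.ContIncl B) (h' : B.ContIncl A) :
    A = B := by
  obtain ⟨A, tA⟩ := A
  obtain ⟨B, tB⟩ := B
  obtain ⟨h1, c1⟩ := h
  obtain ⟨h2, c2⟩ := h'
  obtain rfl : A = B := le_antisymm h1 h2
  congr 1
  exact le_antisymm (continuous_id_iff_le.1 c1) (continuous_id_iff_le.1 c2)

theorem projLim_continuous_inclusion {ι : Type} (A : ι → TopSubspace H) (i : ι) :
    @Continuous _ _ (projLim A).top (A i).top
      (Submodule.inclusion (iInf_le (fun i => (A i).carrier) i)) :=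
  continuous_iInf_dom (i := i) continuous_induced_dom

theorem projLim_contIncl {ι κ : Type} {A : ι → TopSubspace H} {B : κ → TopSubspace H}
    (h : ∀ j, ∃ i, (A i).ContIncl (B j)) : (projLim A).ContIncl (projLim B) := by
  choose f hf hc using h
  refine ⟨le_iInf fun j => (iInf_le _ (f j)).trans (hf j), ?_⟩
  refine continuous_iInf_rng.2 fun j => ?_
  have h1 := @Continuous.comp _ _ _ (projLim A).top (A (f j)).top (B j).top _ _ (hc j)
    (projLim_continuous_inclusion A (f j))
  exact @continuous_induced_rng _ _ _ _ _ (B j).top (projLim A).top |>.2 h1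

theorem IsLCTopology.induced {H K : Type} [AddCommGroup H] [Module ℂ H] [AddCommGroup K]
    [Module ℂ K] (f : H →ₗ[ℂ] K) {t : TopologicalSpace K} (h : IsLCTopology t) :
    IsLCTopology (t.induced f) := by
  obtain ⟨h1, h2, h3⟩ := h
  exact ⟨topologicalAddGroup_induced f, continuousSMul_induced f,
    LocallyConvexSpace.induced (f.restrictScalars ℝ)⟩

/-- An admissible topology of the target, pulled back along the inclusion, is again locally convex
and admissible for the source, hence coarser than the inductive limit topology there. -/
theorem indLim_contIncl {ι κ : Type} {A : ι → TopSubspace H} {B : κ → TopSubspace H}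
    (h : ∀ i, ∃ j, (A i).ContIncl (B j)) : (indLim A).ContIncl (indLim B) := by
  choose f hf hc using h
  refine ⟨iSup_le fun i => (hf i).trans (le_iSup (fun j => (B j).carrier) (f i)), ?_⟩
  refine continuous_sInf_rng.2 fun t ht => continuous_iff_le_induced.2 (sInf_le ?_)
  refine ⟨IsLCTopology.induced _ ht.1, fun i => continuous_induced_rng.2 ?_⟩
  exact @Continuous.comp _ _ _ (A i).top (B (f i)).top t _ _ (ht.2 (f i)) (hc i)

variable (Φ : Functionals H)

theorem stepSpace_contIncl {a b : ℕ → ℝ} (ha : ∀ p, 0 < a p) (hb : ∀ p, 0 < b p) {C : ℝ}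
    (h : ∀ p, a p ≤ C * b p) : (stepSpace Φ a).ContIncl (stepSpace Φ b) := by
  have hC : 0 ≤ C := by
    have := (ha 0).trans_le (h 0)
    exact (pos_of_mul_pos_left this (hb 0).le).le
  have key : ∀ (f : H) (t : Φ.T),
      ‖Φ.D t f‖ / |b (Φ.ord t)| ≤ C * (‖Φ.D t f‖ / |a (Φ.ord t)|) := by
    intro f t
    have ha' := ha (Φ.ord t)
    have hb' := hb (Φ.ord t)
    rw [abs_of_pos ha', abs_of_pos hb', ← mul_div_assoc, div_le_div_iff₀ hb' ha']
    have := mul_le_mul_of_nonneg_left (h (Φ.ord t)) (norm_nonneg (Φ.D t f))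
    linarith
  have hle : stepCarrier Φ a ≤ stepCarrier Φ b := by
    rintro f ⟨A, hA⟩
    refine ⟨C * A, ?_⟩
    rintro _ ⟨t, rfl⟩
    exact (key f t).trans (mul_le_mul_of_nonneg_left (hA ⟨t, rfl⟩) hC)
  refine ⟨hle, ?_⟩
  let _ := (stepSeminorm Φ a).toAddGroupSeminorm.toSeminormedAddCommGroup
  let _ := (stepSeminorm Φ b).toAddGroupSeminorm.toSeminormedAddCommGroup
  change Continuous (Submodule.inclusion hle)
  refine AddMonoidHomClass.continuous_of_bound (Submodule.inclusion hle) C fun f => ?_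
  change (⨆ t, ‖Φ.D t f‖ / |b (Φ.ord t)|) ≤ C * ⨆ t, ‖Φ.D t f‖ / |a (Φ.ord t)|
  rw [Real.mul_iSup_of_nonneg hC]
  -- The bound must be nonnegative since the index set may be empty, as for `U = ∅`.
  refine Real.iSup_le (fun t => (key f t).trans ?_)
    (Real.iSup_nonneg fun t => mul_nonneg hC (by positivity))
  refine le_ciSup (f := fun t => C * (‖Φ.D t f‖ / |a (Φ.ord t)|)) ?_ t
  obtain ⟨A, hA⟩ := f.2
  refine ⟨C * A, ?_⟩
  rintro _ ⟨t, rfl⟩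
  exact mul_le_mul_of_nonneg_left (hA ⟨t, rfl⟩) hC

end TopSubspace

/-- `a ≤ C b` for some constant `C`. -/
def SeqDom (a b : ℕ → ℝ) : Prop := ∃ C : ℝ, ∀ p, a p ≤ C * b p

/-- Two families of positive sequences that are cofinal and coinitial in each other, up to constant
factors, define the same weighted spaces. -/
theorem SameSpaces.of_seqDom {ι κ : Type} {a : ι → ℕ → ℝ} {b : κ → ℕ → ℝ}
    (ha : ∀ i p, 0 < a i p) (hb : ∀ j p, 0 < b j p)
    (hab : ∀ i, ∃ j, SeqDom (a i) (b j)) (hba : ∀ j, ∃ i, SeqDom (b j) (a i))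
    (hab' : ∀ j, ∃ i, SeqDom (a i) (b j)) (hba' : ∀ i, ∃ j, SeqDom (b j) (a i)) :
    SameSpaces a b := by
  have key : ∀ (k : SpaceKind) {H : Type} [AddCommGroup H] [Module ℂ H] (Φ : Functionals H),
      weightedSpace Φ a k = weightedSpace Φ b k := by
    intro k H _ _ Φ
    have step1 : ∀ i j, SeqDom (a i) (b j) → (stepSpace Φ (a i)).ContIncl (stepSpace Φ (b j)) :=
      fun i j ⟨_, h⟩ => TopSubspace.stepSpace_contIncl Φ (ha i) (hb j) h
    have step2 : ∀ i j, SeqDom (b j) (a i) → (stepSpace Φ (b j)).ContIncl (stepSpace Φ (a i)) :=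
      fun i j ⟨_, h⟩ => TopSubspace.stepSpace_contIncl Φ (hb j) (ha i) h
    cases k with
    | roumieu =>
      exact (TopSubspace.indLim_contIncl fun i => (hab i).imp fun j => step1 i j).antisymm
        (TopSubspace.indLim_contIncl fun j => (hba j).imp fun i => step2 i j)
    | beurling =>
      exact (TopSubspace.projLim_contIncl fun j => (hab' j).imp fun i => step1 i j).antisymm
        (TopSubspace.projLim_contIncl fun i => (hba' i).imp fun j => step2 i j)
  intro k
  refine ⟨fun d U => ?_, fun d U => key k _, fun G => key k _, fun d => key k _, key k _,
    fun d c => key k _⟩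
  -- `spaceE` is not itself a weighted space, but a pullback of weighted spaces on the sets `V`.
  unfold spaceE spaceB
  simp only [key k]

/-! ## Weight sequences and their associated functions -/

/-- Normalized, logarithmically convex sequences `M ≥ 1` with `(M_p)^(1/p) → ∞`, the last condition
in the form that `p y - log M_p` is bounded above for each `y`. -/
structure IsWeightSeq (M : ℕ → ℝ) : Prop where
  map_zero : M 0 = 1
  one_le : ∀ p, 1 ≤ M p
  convex : ∀ p, 2 * Real.log (M (p + 1)) ≤ Real.log (M p) + Real.log (M (p + 2))
  bdd : ∀ y : ℝ, ∃ D : ℝ, ∀ p : ℕ, p * y - Real.log (M p) ≤ D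

namespace IsWeightSeq

variable {M N : ℕ → ℝ}

theorem pos (h : IsWeightSeq M) (p : ℕ) : 0 < M p := zero_lt_one.trans_le (h.one_le p)

theorem log_nonneg (h : IsWeightSeq M) (p : ℕ) : 0 ≤ Real.log (M p) := Real.log_nonneg (h.one_le p)

theorem mul (hM : IsWeightSeq M) (hN : IsWeightSeq N) : IsWeightSeq (M * N) := by
  have e : ∀ p, Real.log ((M * N) p) = Real.log (M p) + Real.log (N p) := fun p =>
    Real.log_mul (hM.pos p).ne' (hN.pos p).ne'
  refine ⟨by simp [hM.map_zero, hN.map_zero],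
    fun p => one_le_mul_of_one_le_of_one_le (hM.one_le p) (hN.one_le p), fun p => ?_, fun y => ?_⟩
  · simp only [e]
    linarith [hM.convex p, hN.convex p]
  · obtain ⟨D, hD⟩ := hM.bdd y
    refine ⟨D, fun p => ?_⟩
    rw [e]
    linarith [hD p, hN.log_nonneg p]

theorem log_exp_pow_div (h : IsWeightSeq M) (y : ℝ) (p : ℕ) :
    Real.log (Real.exp y ^ p / M p) = p * y - Real.log (M p) := by
  rw [Real.log_div (by positivity) (h.pos p).ne', Real.log_pow, Real.log_exp]

theorem bddAbove_assocSet_exp (h : IsWeightSeq M) (y : ℝ) :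
    BddAbove (assocSet M (Real.exp y)) := by
  obtain ⟨D, hD⟩ := h.bdd y
  refine ⟨D, ?_⟩
  rintro _ ⟨p, rfl⟩
  simpa only [h.log_exp_pow_div] using hD p

theorem assocSet_nonpos (h : IsWeightSeq M) {t : ℝ} (ht : t ∈ Icc (0 : ℝ) 1) :
    ∀ x ∈ assocSet M t, x ≤ 0 := by
  rintro _ ⟨p, rfl⟩
  exact Real.log_nonpos (div_nonneg (pow_nonneg ht.1 p) (h.pos p).le)
    ((div_le_one (h.pos p)).2 ((pow_le_one₀ ht.1 ht.2).trans (h.one_le p)))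

theorem bddAbove_assocSet (h : IsWeightSeq M) {t : ℝ} (ht : 0 ≤ t) : BddAbove (assocSet M t) := by
  rcases ht.eq_or_lt with rfl | ht
  · exact ⟨0, h.assocSet_nonpos (by simp)⟩
  · simpa [Real.exp_log ht] using h.bddAbove_assocSet_exp (Real.log t)

theorem assocFun_nonneg (h : IsWeightSeq M) {t : ℝ} (ht : 0 ≤ t) : 0 ≤ assocFun M t :=
  le_csSup (h.bddAbove_assocSet ht) ⟨0, by simp [h.map_zero]⟩

theorem assocFun_eq_zero (h : IsWeightSeq M) {t : ℝ} (ht : t ∈ Icc (0 : ℝ) 1) :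
    assocFun M t = 0 :=
  le_antisymm (csSup_le (range_nonempty _) (h.assocSet_nonpos ht)) (h.assocFun_nonneg ht.1)

theorem le_assocFun_exp (h : IsWeightSeq M) (y : ℝ) (p : ℕ) :
    p * y - Real.log (M p) ≤ assocFun M (Real.exp y) :=
  le_csSup (h.bddAbove_assocSet_exp y) ⟨p, h.log_exp_pow_div y p⟩

theorem assocFun_exp_le (h : IsWeightSeq M) {y c : ℝ}
    (hc : ∀ p : ℕ, p * y - Real.log (M p) ≤ c) : assocFun M (Real.exp y) ≤ c := by
  refine csSup_le (range_nonempty _) ?_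
  rintro _ ⟨p, rfl⟩
  simpa only [h.log_exp_pow_div] using hc p

/-- In `y` the function is a supremum of lines with slopes `p`: hence convex, and eventually above
every line. -/
theorem isWeight_assocFun (h : IsWeightSeq M) : IsWeight (assocFun M) := by
  refine IsWeight.of_growth ?_ (fun t ht => h.assocFun_eq_zero ht) ?_ ?_
  · intro t ht u hu htu
    rcases (show (0 : ℝ) ≤ t from ht).eq_or_lt with rfl | ht'
    · rw [h.assocFun_eq_zero (by simp)]
      exact h.assocFun_nonneg hu
    · have hu' := ht'.trans_le htu
      rw [← Real.exp_log ht', ← Real.exp_log hu']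
      refine h.assocFun_exp_le fun p => le_trans ?_ (h.le_assocFun_exp _ p)
      have := Real.log_le_log ht' htu
      gcongr
  · intro C _
    obtain ⟨p, hp⟩ := exists_nat_ge C
    refine ⟨Real.log (M p), fun y hy => ?_⟩
    have h1 := h.le_assocFun_exp y p
    have h2 := mul_le_mul_of_nonneg_right hp hy
    linarith
  · refine ⟨convex_univ, fun y _ z _ a b ha hb hab => h.assocFun_exp_le fun p => ?_⟩
    have h1 := mul_le_mul_of_nonneg_left (h.le_assocFun_exp y p) ha
    have h2 := mul_le_mul_of_nonneg_left (h.le_assocFun_exp z p) hb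
    have h3 : a * Real.log (M p) + b * Real.log (M p) = Real.log (M p) := by
      rw [← add_mul, hab, one_mul]
    simp only [smul_eq_mul]
    linarith

/-- The supremum in the definition of the associated function is attained. -/
theorem exists_max (h : IsWeightSeq M) (y : ℝ) :
    ∃ p : ℕ, ∀ q : ℕ, q * y - Real.log (M q) ≤ p * y - Real.log (M p) := by
  have h1 : Tendsto (fun p : ℕ => p * y - Real.log (M p)) cofinite atBot := by
    rw [Nat.cofinite_eq_atTop]
    -- The bound at `y + 1` leaves `-p` to spare at `y`.
    obtain ⟨D, hD⟩ := h.bdd (y + 1)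
    refine tendsto_atBot_mono (f := fun p : ℕ => D + -(p : ℝ)) (fun p => by linarith [hD p]) ?_
    exact tendsto_atBot_add_const_left _ _
      (tendsto_neg_atTop_atBot.comp tendsto_natCast_atTop_atTop)
  exact h1.exists_forall_ge

/-- A point between two consecutive quotients of a logarithmically convex sequence determines the
index at which the supremum in the associated function is attained. -/
theorem assocFun_exp_le_of_quotients (h : IsWeightSeq M) {y : ℝ} {p : ℕ}
    (hu : y ≤ Real.log (M (p + 1)) - Real.log (M p))
    (hl : ∀ k, p = k + 1 → Real.log (M (k + 1)) - Real.log (M k) ≤ y) :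
    assocFun M (Real.exp y) ≤ p * y - Real.log (M p) := by
  -- Since the increments of `log M` are monotone, `q y - log M_q` rises up to `q = p` and does not
  -- rise afterwards.
  have mono : Monotone fun k => Real.log (M (k + 1)) - Real.log (M k) :=
    monotone_nat_of_le_succ fun k => by linarith [h.convex k]
  refine h.assocFun_exp_le fun q => ?_
  rcases le_total p q with hq | hq
  · induction q, hq using Nat.le_induction with
    | base => exact le_rfl
    | succ q hq ih =>
      have := mono hq
      push_cast
      linarith
  · obtain ⟨d, rfl⟩ := Nat.exists_eq_add_of_le hq
    have key : ∀ k, k ≤ d →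
        (q : ℝ) * y - Real.log (M q) ≤ (q + k : ℕ) * y - Real.log (M (q + k)) := by
      intro k hk
      induction k with
      | zero => simp
      | succ k ih =>
        have h1 := ih (by omega)
        have h2 := hl (q + d - 1) (by omega)
        have h3 := mono (show q + k ≤ q + d - 1 by omega)
        simp only at h3
        rw [← add_assoc]
        push_cast at h1 ⊢
        linarith
    exact key d le_rfl

/-- For logarithmically convex sequences the associated function of the product is the lower
Legendre conjugate of the associated functions. -/
theorem assocFun_mul (hM : IsWeightSeq M) (hN : IsWeightSeq N) {t : ℝ} (ht : 0 ≤ t) :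
    assocFun (M * N) t = lowerConj (assocFun M) (assocFun N) t := by
  have hMN := hM.mul hN
  have e : ∀ p, Real.log ((M * N) p) = Real.log (M p) + Real.log (N p) := fun p =>
    Real.log_mul (hM.pos p).ne' (hN.pos p).ne'
  rcases ht.eq_or_lt with rfl | ht
  · rw [hMN.assocFun_eq_zero (by simp),
      (hM.isWeight_assocFun.lowerConj hN.isWeight_assocFun).map_zero]
  obtain ⟨x, rfl⟩ : ∃ x, Real.exp x = t := ⟨_, Real.exp_log ht⟩
  apply le_antisymm
  · refine le_lowerConj_exp fun u => hMN.assocFun_exp_le fun p => ?_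
    rw [e]
    linarith [hM.le_assocFun_exp u p, hN.le_assocFun_exp (x - u) p]
  -- Let `μ_k`, `ν_k` be the increments of `log M`, `log N`. Optimality of `p` gives `μ_{p-1} +
  -- ν_{p-1} ≤ x ≤ μ_p + ν_p`, so some `y` satisfies `μ_{p-1} ≤ y ≤ μ_p` and `ν_{p-1} ≤ x - y ≤
  -- ν_p`. Then `p` is optimal for `M` at `y` and for `N` at `x - y`.
  · obtain ⟨p, hp⟩ := hMN.exists_max x
    simp only [e] at hp
    have hup := hp (p + 1)
    push_cast at hup
    obtain ⟨y, h1, h2, h3, h4⟩ : ∃ y,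
        y ≤ Real.log (M (p + 1)) - Real.log (M p) ∧
        (∀ k, p = k + 1 → Real.log (M (k + 1)) - Real.log (M k) ≤ y) ∧
        x - y ≤ Real.log (N (p + 1)) - Real.log (N p) ∧
        (∀ k, p = k + 1 → Real.log (N (k + 1)) - Real.log (N k) ≤ x - y) := by
      cases p with
      | zero =>
        refine ⟨_, le_rfl, fun k hk => absurd hk (by omega), by linarith,
          fun k hk => absurd hk (by omega)⟩
      | succ k =>
        have hlow := hp k
        have c1 := hM.convex k
        have c2 := hN.convex k
        push_cast at hlow hup
        -- The larger of the two lower bounds on `y`; both upper bounds exceed it by convexity and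
        -- by optimality of `p`.
        refine ⟨max (Real.log (M (k + 1)) - Real.log (M k))
          (x - (Real.log (N (k + 1 + 1)) - Real.log (N (k + 1)))), ?_, ?_, ?_, ?_⟩
        · exact max_le (by linarith) (by linarith)
        · intro j hj
          obtain rfl : k = j := by omega
          exact le_max_left _ _
        · linarith [le_max_right (Real.log (M (k + 1)) - Real.log (M k))
            (x - (Real.log (N (k + 1 + 1)) - Real.log (N (k + 1))))]
        · intro j hj
          obtain rfl : k = j := by omega
          rw [le_sub_comm]
          exact max_le (by linarith) (by linarith)
    have h5 := lowerConj_exp_add_le (fun t => hM.assocFun_nonneg (t := t))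
      (fun t => hN.assocFun_nonneg (t := t)) y (x - y)
    have h6 := hM.assocFun_exp_le_of_quotients h1 h2
    have h7 := hN.assocFun_exp_le_of_quotients h3 h4
    have h8 := hMN.le_assocFun_exp x p
    rw [e] at h8
    rw [add_sub_cancel] at h5
    linarith

end IsWeightSeq

/-! ## The weight matrix associated with a weight function -/

theorem assocMatrix_pos (ω : ℝ → ℝ) (ℓ : ℝ) (p : ℕ) : 0 < assocMatrix ω ℓ p := Real.exp_pos _

/-- With `le_log_assocMatrix` this says that `log W^(ℓ)_p` is the supremum of `p y - ω(e^y) / ℓ`;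
the later estimates of rows rest on these two bounds. -/
theorem assocMatrix_le {ω : ℝ → ℝ} {ℓ c : ℝ} (hℓ : 0 < ℓ) {p : ℕ}
    (h : ∀ y : ℝ, 0 ≤ y → p * y - ω (Real.exp y) / ℓ ≤ c) :
    assocMatrix ω ℓ p ≤ Real.exp c := by
  rw [assocMatrix, Real.exp_le_exp, one_div_mul_eq_div, div_le_iff₀ hℓ]
  refine youngConj_le fun y hy => ?_
  have h1 := mul_le_mul_of_nonneg_right (h y hy) hℓ.le
  rw [sub_mul, div_mul_cancel₀ _ hℓ.ne'] at h1
  linarith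

namespace IsWeight

variable {ω : ℝ → ℝ}

theorem le_log_assocMatrix (h : IsWeight ω) {ℓ : ℝ} (hℓ : 0 < ℓ) (p : ℕ) (y : ℝ) :
    p * y - ω (Real.exp y) / ℓ ≤ Real.log (assocMatrix ω ℓ p) := by
  rw [assocMatrix, Real.log_exp, one_div_mul_eq_div, le_div_iff₀ hℓ, sub_mul,
    div_mul_cancel₀ _ hℓ.ne']
  have := h.le_youngConj (show 0 ≤ ℓ * p by positivity) y
  linarith

theorem isWeightSeq_assocMatrix (h : IsWeight ω) {ℓ : ℝ} (hℓ : 0 < ℓ) :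
    IsWeightSeq (assocMatrix ω ℓ) where
  map_zero := by
    apply le_antisymm
    · rw [← Real.exp_zero]
      refine assocMatrix_le hℓ fun y _ => ?_
      have := div_nonneg (h.exp_nonneg y) hℓ.le
      simpa using this
    · exact Real.one_le_exp (mul_nonneg (by positivity) (h.youngConj_nonneg (by positivity)))
  one_le p := Real.one_le_exp (mul_nonneg (by positivity) (h.youngConj_nonneg (by positivity)))
  convex p := by
    have h1 : assocMatrix ω ℓ (p + 1) ≤ Real.exp
        ((Real.log (assocMatrix ω ℓ p) + Real.log (assocMatrix ω ℓ (p + 2))) / 2) := by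
      refine assocMatrix_le hℓ fun y _ => ?_
      have h1 := h.le_log_assocMatrix hℓ p y
      have h2 := h.le_log_assocMatrix hℓ (p + 2) y
      push_cast at h2 ⊢
      linarith
    have := Real.log_le_log (assocMatrix_pos _ _ _) h1
    rw [Real.log_exp] at this
    linarith
  bdd y := ⟨ω (Real.exp y) / ℓ, fun p => by linarith [h.le_log_assocMatrix hℓ p y]⟩

theorem assocMatrix_mono (h : IsWeight ω) {ℓ j : ℝ} (hℓ : 0 < ℓ) (hj : ℓ ≤ j) (p : ℕ) :
    assocMatrix ω ℓ p ≤ assocMatrix ω j p := by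
  have hj0 := hℓ.trans_le hj
  rw [← Real.exp_log (assocMatrix_pos ω j p)]
  refine assocMatrix_le hℓ fun y _ => ?_
  have h1 := div_le_div_of_nonneg_left (h.exp_nonneg y) hℓ hj
  linarith [h.le_log_assocMatrix hj0 p y]

/-- The penalty `ω / ℓ` splits into two halves `ω / (2ℓ)`, one for `p` and one for `q`. -/
theorem moderateGrowth (h : IsWeight ω) : ModerateGrowth (assocMatrix ω) := by
  intro ℓ hℓ p q
  have h2 : 0 < 2 * ℓ := by positivity
  rw [← Real.exp_log (assocMatrix_pos ω (2 * ℓ) p), ← Real.exp_log (assocMatrix_pos ω (2 * ℓ) q),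
    ← Real.exp_add]
  refine assocMatrix_le hℓ fun y _ => ?_
  have h3 := h.le_log_assocMatrix h2 p y
  have h4 := h.le_log_assocMatrix h2 q y
  have h5 : ω (Real.exp y) / (2 * ℓ) = ω (Real.exp y) / ℓ / 2 := by field_simp
  rw [h5] at h3 h4
  push_cast
  linarith

theorem assocFun_assocMatrix_le (h : IsWeight ω) {ℓ : ℝ} (hℓ : 0 < ℓ) {t : ℝ} (ht : 0 ≤ t) :
    assocFun (assocMatrix ω ℓ) t ≤ ω t / ℓ := by
  have hs := h.isWeightSeq_assocMatrix hℓ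
  rcases ht.eq_or_lt with rfl | ht
  · rw [hs.assocFun_eq_zero (by simp), h.map_zero, zero_div]
  · rw [← Real.exp_log ht]
    exact hs.assocFun_exp_le fun p => by linarith [h.le_log_assocMatrix hℓ p (Real.log t)]

/-- A supporting slope `x` at `y` gives equality in Young's inequality. Rounding `x / ℓ` down to an
integer costs at most `ℓ y ≤ (ω(e^y) + D) / 2`; moving half of `ω` to the left yields the factor
`2ℓ`. -/
theorem exists_le_assocFun_assocMatrix (h : IsWeight ω) {ℓ : ℝ} (hℓ : 0 < ℓ) :
    ∃ D : ℝ, ∀ t : ℝ, 0 ≤ t → ω t ≤ 2 * ℓ * assocFun (assocMatrix ω ℓ) t + D := by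
  have hs := h.isWeightSeq_assocMatrix hℓ
  obtain ⟨D, hD0, hD⟩ := h.exists_linear_le (show 0 ≤ 2 * ℓ by positivity)
  refine ⟨D, fun t ht => ?_⟩
  have hn : 0 ≤ 2 * ℓ * assocFun (assocMatrix ω ℓ) t :=
    mul_nonneg (by positivity) (hs.assocFun_nonneg ht)
  rcases le_total t 1 with ht1 | ht1
  · rw [h.normalized t ⟨ht, ht1⟩]
    linarith
  obtain ⟨y, rfl⟩ : ∃ y, Real.exp y = t := ⟨_, Real.exp_log (by linarith)⟩
  have hy : 0 ≤ y := Real.one_le_exp_iff.1 ht1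
  obtain ⟨x, hx, hxy⟩ := h.exists_eq_young y
  have h1 : ℓ * ⌊x / ℓ⌋₊ ≤ x := by
    have := Nat.floor_le (show 0 ≤ x / ℓ by positivity)
    rwa [le_div_iff₀' hℓ] at this
  have h2 : x < ℓ * (⌊x / ℓ⌋₊ + 1) := by
    have := Nat.lt_floor_add_one (x / ℓ)
    rwa [div_lt_iff₀' hℓ] at this
  have h3 := hs.le_assocFun_exp y ⌊x / ℓ⌋₊
  have h4 := h.youngConj_mono (by positivity) h1
  rw [assocMatrix, Real.log_exp, one_div_mul_eq_div, ← mul_le_mul_iff_right₀ hℓ, mul_sub,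
    mul_div_cancel₀ _ hℓ.ne'] at h3
  have h5 := mul_le_mul_of_nonneg_right h2.le hy
  have h6 := hD y
  linarith

end IsWeight

/-! ## Comparison of weight matrices -/

/-- A domination of weight functions gives a domination of the associated matrices. -/
theorem IsWeight.assocMatrix_le_of_le {ω ω' : ℝ → ℝ} (h : IsWeight ω) {B C D : ℝ} (hC : 0 < C)
    (hω : ∀ y : ℝ, 0 ≤ y → ω (Real.exp (y + B)) ≤ C * ω' (Real.exp y) + D) {ℓ : ℝ} (hℓ : 0 < ℓ)
    (p : ℕ) :
    Real.exp B ^ p * assocMatrix ω' ℓ p ≤ Real.exp (D / (C * ℓ)) * assocMatrix ω (C * ℓ) p := by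
  have hCℓ := mul_pos hC hℓ
  rw [← Real.exp_nat_mul, ← le_div_iff₀' (Real.exp_pos _),
    ← Real.exp_log (assocMatrix_pos ω (C * ℓ) p), ← Real.exp_add, ← Real.exp_sub]
  refine assocMatrix_le hℓ fun y hy => ?_
  -- Testing at the shifted point `y + B` produces the factor `e^{Bp}`.
  have h1 := h.le_log_assocMatrix hCℓ p (y + B)
  have h2 := div_le_div_of_nonneg_right (hω y hy) hCℓ.le
  rw [add_div, mul_div_mul_left _ _ hC.ne'] at h2
  linarith

theorem Omega1.exists_pow_le {ω : ℝ → ℝ} (h1 : Omega1 ω) (n : ℕ) :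
    ∃ C : ℝ, 1 ≤ C ∧ ∃ D : ℝ, ∀ t : ℝ, 0 ≤ t → ω (2 ^ n * t) ≤ C * ω t + D := by
  obtain ⟨L, hL, h1⟩ := h1
  induction n with
  | zero => exact ⟨1, le_rfl, 0, fun t _ => by simp⟩
  | succ n ih =>
    obtain ⟨C, hC, D, ih⟩ := ih
    refine ⟨L * C, one_le_mul_of_one_le_of_one_le hL hC, L * (D + 1), fun t ht => ?_⟩
    have h2 := h1 (2 ^ n * t) (by positivity)
    have h3 := mul_le_mul_of_nonneg_left (ih t ht) (zero_le_one.trans hL)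
    rw [pow_succ', mul_assoc]
    linarith

/-- A factor `k^p` is a shift of `y` by `log k`. Iterated `(ω₁)` pays for it with a factor `C` on
`ω`, thus on `ℓ`, that depends on `k` alone; the additive constant only enters `D`. -/
theorem IsWeight.expAbsorb {ω : ℝ → ℝ} (h : IsWeight ω) (h1 : Omega1 ω) :
    ExpAbsorb (assocMatrix ω) := by
  intro k hk
  obtain ⟨n, hn⟩ := pow_unbounded_of_one_lt k (one_lt_two (α := ℝ))
  obtain ⟨C, hC, D, hCD⟩ := h1.exists_pow_le n
  have hk0 : 0 < k := by linarith
  refine ⟨C, hC, fun ℓ hℓ => ⟨max 1 (Real.exp (D / (C * ℓ))), le_max_left _ _, fun p => ?_⟩⟩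
  have h2 := h.assocMatrix_le_of_le (ω' := ω) (B := Real.log k) (C := C) (D := D) (by linarith)
    (fun y _ => by
      refine le_trans ?_ (hCD _ (Real.exp_pos y).le)
      rw [Real.exp_add, Real.exp_log hk0, mul_comm]
      exact h.monotoneOn (mem_Ici.2 (by positivity)) (mem_Ici.2 (by positivity)) (by gcongr))
    hℓ p
  rw [Real.exp_log hk0] at h2
  exact h2.trans (mul_le_mul_of_nonneg_right (le_max_right _ _) (assocMatrix_pos _ _ _).le)

/-- A weight function and its associated matrix define the same spaces if the matrix absorbs
exponential growth. -/
theorem sameSpaces_matFamily_funFamily {ω : ℝ → ℝ} (h : IsWeight ω) (h1 : Omega1 ω) :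
    SameSpaces (matFamily (assocMatrix ω)) (funFamily ω) := by
  have ha := h.expAbsorb h1
  have key : ∀ k : ℝ, ∃ d : ℝ, 0 < d ∧ ∀ ℓ : ℝ, 0 < ℓ → 0 ≤ k → ∃ D : ℝ, ∀ p : ℕ,
      k ^ p * assocMatrix ω ℓ p ≤ D * assocMatrix ω (d * ℓ) p := by
    intro k
    obtain ⟨d, hd, h2⟩ := ha (max k 1) (le_max_right _ _)
    refine ⟨d, by linarith, fun ℓ hℓ hk => ?_⟩
    obtain ⟨D, -, h2⟩ := h2 ℓ hℓ
    refine ⟨D, fun p => le_trans ?_ (h2 p)⟩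
    exact mul_le_mul_of_nonneg_right (pow_le_pow_left₀ hk (le_max_left _ _) p)
      (assocMatrix_pos _ _ _).le
  have pos1 : ∀ i p, 0 < matFamily (assocMatrix ω) i p := fun i p =>
    mul_pos (pow_pos i.2.2 p) (assocMatrix_pos _ _ _)
  refine SameSpaces.of_seqDom pos1 (fun j p => assocMatrix_pos _ _ _) ?_ ?_ ?_ ?_
  · rintro ⟨⟨ℓ, hℓ⟩, ⟨k, hk⟩⟩
    obtain ⟨d, hd, h2⟩ := key k
    exact ⟨⟨d * ℓ, mul_pos hd hℓ⟩, h2 ℓ hℓ (le_of_lt hk)⟩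
  · exact fun j => ⟨⟨j, ⟨1, one_pos (α := ℝ)⟩⟩, 1, fun p => by simp [matFamily, funFamily]⟩
  · exact fun j => ⟨⟨j, ⟨1, one_pos (α := ℝ)⟩⟩, 1, fun p => by simp [matFamily, funFamily]⟩
  · rintro ⟨⟨ℓ, hℓ⟩, ⟨k, hk⟩⟩
    have hk' : 0 < k := hk
    have hℓ' : 0 < ℓ := hℓ
    -- In the Beurling case a row below `k^p W^(ℓ)` is needed, so `k⁻¹` is absorbed, starting from
    -- the smaller parameter `ℓ / d`.
    obtain ⟨d, hd, h2⟩ := key k⁻¹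
    obtain ⟨D, h2⟩ := h2 (ℓ / d) (div_pos hℓ' hd) (inv_nonneg.2 hk'.le)
    refine ⟨⟨ℓ / d, div_pos hℓ' hd⟩, D, fun p => ?_⟩
    have h3 := h2 p
    rw [mul_div_cancel₀ _ hd.ne', inv_pow, inv_mul_le_iff₀ (pow_pos hk' p)] at h3
    simp only [matFamily, funFamily]
    linarith

/-- Equivalent weight functions define the same spaces. -/
theorem sameSpaces_funFamily {ω ω' : ℝ → ℝ} (h : IsWeight ω) (h' : IsWeight ω') {C D C' D' : ℝ}
    (hC : 0 < C) (hC' : 0 < C') (hω : ∀ t, 0 ≤ t → ω t ≤ C * ω' t + D)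
    (hω' : ∀ t, 0 ≤ t → ω' t ≤ C' * ω t + D') : SameSpaces (funFamily ω) (funFamily ω') := by
  have key : ∀ {ω ω' : ℝ → ℝ} {C D : ℝ}, IsWeight ω → 0 < C →
      (∀ t, 0 ≤ t → ω t ≤ C * ω' t + D) → ∀ ℓ : ℝ, 0 < ℓ →
      SeqDom (assocMatrix ω' ℓ) (assocMatrix ω (C * ℓ)) := by
    intro ω ω' C D h hC hω ℓ hℓ
    refine ⟨Real.exp (D / (C * ℓ)), fun p => ?_⟩
    have := h.assocMatrix_le_of_le (ω' := ω') (B := 0) (C := C) (D := D) hC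
      (fun y _ => by rw [add_zero]; exact hω _ (Real.exp_pos y).le) hℓ p
    simpa using this
  have key' : ∀ {ω ω' : ℝ → ℝ} {C D : ℝ}, IsWeight ω → 0 < C →
      (∀ t, 0 ≤ t → ω t ≤ C * ω' t + D) → ∀ ℓ : ℝ, 0 < ℓ →
      SeqDom (assocMatrix ω' (ℓ / C)) (assocMatrix ω ℓ) := by
    intro ω ω' C D h hC hω ℓ hℓ
    have := key h hC hω (ℓ / C) (div_pos hℓ hC)
    rwa [mul_div_cancel₀ _ hC.ne'] at this
  refine SameSpaces.of_seqDom (fun _ _ => assocMatrix_pos _ _ _) (fun _ _ => assocMatrix_pos _ _ _)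
    ?_ ?_ ?_ ?_
  · rintro ⟨ℓ, hℓ⟩
    exact ⟨⟨C' * ℓ, mul_pos hC' hℓ⟩, key h' hC' hω' ℓ hℓ⟩
  · rintro ⟨ℓ, hℓ⟩
    exact ⟨⟨C * ℓ, mul_pos hC hℓ⟩, key h hC hω ℓ hℓ⟩
  · rintro ⟨ℓ, hℓ⟩
    exact ⟨⟨ℓ / C', div_pos hℓ hC'⟩, key' h' hC' hω' ℓ hℓ⟩
  · rintro ⟨ℓ, hℓ⟩
    exact ⟨⟨ℓ / C, div_pos hℓ hC⟩, key' h hC hω ℓ hℓ⟩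

/-- `M_p ≤ C h^p N_p` for some constants `C` and `h`. -/
def SeqDomExp (M N : ℕ → ℝ) : Prop :=
  ∃ C h : ℝ, 0 < C ∧ 0 < h ∧ ∀ p, M p ≤ C * h ^ p * N p

theorem SeqDomExp.trans {M N P : ℕ → ℝ} (h1 : SeqDomExp M N) (h2 : SeqDomExp N P) :
    SeqDomExp M P := by
  obtain ⟨C, h, hC, hh, h1⟩ := h1
  obtain ⟨D, k, hD, hk, h2⟩ := h2
  refine ⟨C * D, h * k, mul_pos hC hD, mul_pos hh hk, fun p => (h1 p).trans ?_⟩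
  have := mul_le_mul_of_nonneg_left (h2 p) (show 0 ≤ C * h ^ p by positivity)
  rw [mul_pow]
  linarith

theorem SeqDomExp.mul_left {M N : ℕ → ℝ} (h : SeqDomExp M N) {P : ℕ → ℝ} (hP : ∀ p, 0 < P p) :
    SeqDomExp (P * M) (P * N) := by
  obtain ⟨C, k, hC, hk, h⟩ := h
  refine ⟨C, k, hC, hk, fun p => ?_⟩
  have := mul_le_mul_of_nonneg_left (h p) (hP p).le
  simp only [Pi.mul_apply]
  linarith

theorem SeqDomExp.seqLE {M N : ℕ → ℝ} (h : SeqDomExp M N) (hM : ∀ p, 0 < M p)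
    (hN : ∀ p, 0 < N p) : SeqLE M N := by
  obtain ⟨C, k, hC, hk, h⟩ := h
  -- For `p ≥ 1` the constant satisfies `C ≤ (max C 1)^p`, so it survives the `p`-th root.
  refine ⟨max C 1 * k, ?_⟩
  rintro _ ⟨p, hp, rfl⟩
  have h1 : M p / N p ≤ (max C 1 * k) ^ p := by
    rw [div_le_iff₀ (hN p)]
    refine (h p).trans ?_
    rw [mul_pow]
    have : C ≤ max C 1 ^ p :=
      (le_max_left C 1).trans (le_self_pow₀ (le_max_right _ _) (by omega))
    have := (hN p).le
    gcongr
  have h2 := Real.rpow_le_rpow (div_pos (hM p) (hN p)).le h1 (show 0 ≤ 1 / (p : ℝ) by positivity)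
  rwa [one_div, Real.pow_rpow_inv_natCast (by positivity) (by omega), ← one_div] at h2

/-- Two weight matrices whose rows are equivalent row by row are equivalent and define the same
spaces. -/
theorem matEquiv_and_sameSpaces {M N : ℝ → ℕ → ℝ} (hM : ∀ ℓ p, 0 < M ℓ p) (hN : ∀ ℓ p, 0 < N ℓ p)
    (h1 : ∀ ℓ, 0 < ℓ → SeqDomExp (M ℓ) (N ℓ)) (h2 : ∀ ℓ, 0 < ℓ → SeqDomExp (N ℓ) (M ℓ)) :
    MatEquiv M N ∧ SameSpaces (matFamily M) (matFamily N) := by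
  have le1 : ∀ ℓ, 0 < ℓ → SeqLE (M ℓ) (N ℓ) := fun ℓ hℓ => (h1 ℓ hℓ).seqLE (hM ℓ) (hN ℓ)
  have le2 : ∀ ℓ, 0 < ℓ → SeqLE (N ℓ) (M ℓ) := fun ℓ hℓ => (h2 ℓ hℓ).seqLE (hN ℓ) (hM ℓ)
  -- The row `ℓ` is kept and only `h` changes: multiplied by `c` to enlarge the target, divided by
  -- `c` to shrink the source.
  have up : ∀ {M N : ℝ → ℕ → ℝ}, (∀ ℓ, 0 < ℓ → SeqDomExp (M ℓ) (N ℓ)) →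
      ∀ i, ∃ j, SeqDom (matFamily M i) (matFamily N j) := by
    rintro M N h ⟨⟨ℓ, hℓ⟩, ⟨k, hk⟩⟩
    have hk' : 0 < k := hk
    obtain ⟨C, c, hC, hc, h⟩ := h ℓ hℓ
    refine ⟨⟨⟨ℓ, hℓ⟩, ⟨k * c, mul_pos hk' hc⟩⟩, C, fun p => ?_⟩
    have := mul_le_mul_of_nonneg_left (h p) (pow_pos hk' p).le
    simp only [matFamily, mul_pow]
    linarith
  have down : ∀ {M N : ℝ → ℕ → ℝ}, (∀ ℓ, 0 < ℓ → SeqDomExp (M ℓ) (N ℓ)) →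
      ∀ j, ∃ i, SeqDom (matFamily M i) (matFamily N j) := by
    rintro M N h ⟨⟨ℓ, hℓ⟩, ⟨k, hk⟩⟩
    have hk' : 0 < k := hk
    obtain ⟨C, c, hC, hc, h⟩ := h ℓ hℓ
    refine ⟨⟨⟨ℓ, hℓ⟩, ⟨k / c, div_pos hk' hc⟩⟩, C, fun p => ?_⟩
    have := mul_le_mul_of_nonneg_left (h p) (pow_pos (div_pos hk' hc) p).le
    have e : (k / c) ^ p * c ^ p = k ^ p := by rw [← mul_pow, div_mul_cancel₀ _ hc.ne']
    simp only [matFamily]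
    calc (k / c) ^ p * M ℓ p ≤ (k / c) ^ p * (C * c ^ p * N ℓ p) := this
      _ = C * (((k / c) ^ p * c ^ p) * N ℓ p) := by ring
      _ = C * (k ^ p * N ℓ p) := by rw [e]
  refine ⟨⟨⟨fun α hα => ⟨α, hα, le1 α hα⟩, fun α hα => ⟨α, hα, le2 α hα⟩⟩,
    ⟨fun α hα => ⟨α, hα, le1 α hα⟩, fun α hα => ⟨α, hα, le2 α hα⟩⟩⟩, ?_⟩
  exact SameSpaces.of_seqDom (fun i p => mul_pos (pow_pos i.2.2 p) (hM _ _))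
    (fun i p => mul_pos (pow_pos i.2.2 p) (hN _ _)) (up h1) (up h2) (down h1) (down h2)

/-- Under `(ω₆)` any two rows of the associated weight matrix are equivalent. -/
theorem IsWeight.seqDomExp_of_omega6 {ω : ℝ → ℝ} (h : IsWeight ω) (h6 : Omega6 ω) {ℓ j : ℝ}
    (hℓ : 0 < ℓ) (hj : 0 < j) : SeqDomExp (assocMatrix ω ℓ) (assocMatrix ω j) := by
  obtain ⟨H, hH, h6⟩ := h6
  have hH0 : 0 < H := by linarith
  -- Evaluating `(ω₆)` at `e^y / H` bounds `ω(e^y) / (2ℓ)` below by `ω(e^y / H) / ℓ` up to a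
  -- constant; the shift by `log H` becomes `H^p`.
  have double : ∀ ℓ : ℝ, 0 < ℓ → SeqDomExp (assocMatrix ω (2 * ℓ)) (assocMatrix ω ℓ) := by
    intro ℓ hℓ
    refine ⟨Real.exp (H / (2 * ℓ)), H, Real.exp_pos _, hH0, fun p => ?_⟩
    have hp : H ^ p = Real.exp (p * Real.log H) := by rw [Real.exp_nat_mul, Real.exp_log hH0]
    rw [hp, ← Real.exp_log (assocMatrix_pos ω ℓ p), ← Real.exp_add, ← Real.exp_add]
    refine assocMatrix_le (by positivity) fun y _ => ?_
    have h1 := h6 (Real.exp (y - Real.log H)) (Real.exp_pos _).le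
    rw [Real.exp_sub, Real.exp_log hH0, mul_div_cancel₀ _ hH0.ne'] at h1
    have h2 := h.le_log_assocMatrix hℓ p (y - Real.log H)
    have h3 := div_le_div_of_nonneg_right h1 (show 0 ≤ 2 * ℓ by positivity)
    rw [mul_div_mul_left _ _ two_ne_zero, add_div] at h3
    rw [Real.exp_sub, Real.exp_log hH0] at h2
    linarith
  have iter : ∀ n : ℕ, SeqDomExp (assocMatrix ω (2 ^ n * j)) (assocMatrix ω j) := by
    intro n
    induction n with
    | zero => exact ⟨1, 1, one_pos, one_pos, fun p => by simp⟩
    | succ n ih =>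
      have := (double (2 ^ n * j) (by positivity)).trans ih
      rwa [← mul_assoc, ← pow_succ'] at this
  obtain ⟨n, hn⟩ := pow_unbounded_of_one_lt (ℓ / j) (one_lt_two (α := ℝ))
  refine SeqDomExp.trans ⟨1, 1, one_pos, one_pos, fun p => ?_⟩ (iter n)
  rw [one_pow, one_mul, one_mul]
  exact h.assocMatrix_mono hℓ ((div_le_iff₀ hj).1 hn.le) p

/-- The associated weight function of a product of rows is equivalent to the lower Legendre
conjugate. -/
theorem exists_assocFun_mul_equiv {σ τ : ℝ → ℝ} (hσ : IsWeight σ) (hτ : IsWeight τ) {ℓ j : ℝ}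
    (hℓ : 0 < ℓ) (hj : 0 < j) :
    ∃ C D C' D' : ℝ, 0 < C ∧ 0 < C' ∧
      (∀ t, 0 ≤ t → assocFun (assocMatrix σ ℓ * assocMatrix τ j) t ≤ C * lowerConj σ τ t + D) ∧
      ∀ t, 0 ≤ t →
        lowerConj σ τ t ≤ C' * assocFun (assocMatrix σ ℓ * assocMatrix τ j) t + D' := by
  have hS := hσ.isWeightSeq_assocMatrix hℓ
  have hT := hτ.isWeightSeq_assocMatrix hj
  have n1 := fun t => hσ.nonneg (t := t)
  have n2 := fun t => hτ.nonneg (t := t)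
  have m1 := fun t => hS.assocFun_nonneg (t := t)
  have m2 := fun t => hT.assocFun_nonneg (t := t)
  obtain ⟨D, hD⟩ := hσ.exists_le_assocFun_assocMatrix hℓ
  obtain ⟨E, hE⟩ := hτ.exists_le_assocFun_assocMatrix hj
  have hC : 0 < ℓ⁻¹ + j⁻¹ := by positivity
  have hC' : 0 < 2 * ℓ + 2 * j := by positivity
  -- Summing the constants of the two factors gives one that serves both; the surplus terms are
  -- nonnegative.
  refine ⟨ℓ⁻¹ + j⁻¹, 0, 2 * ℓ + 2 * j, D + E, hC, hC', fun t ht => ?_, fun t ht => ?_⟩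
  · rw [hS.assocFun_mul hT ht, add_zero, ← div_le_iff₀' hC]
    refine le_lowerConj fun s hs => ?_
    rw [div_le_iff₀' hC]
    have hts := div_nonneg ht hs.le
    have h1 := hσ.assocFun_assocMatrix_le hℓ hs.le
    have h2 := hτ.assocFun_assocMatrix_le hj hts
    have h3 := lowerConj_le m1 m2 hs ht
    have h4 : 0 ≤ j⁻¹ * σ s := mul_nonneg (by positivity) (n1 s hs.le)
    have h5 : 0 ≤ ℓ⁻¹ * τ (t / s) := mul_nonneg (by positivity) (n2 _ hts)
    rw [div_eq_inv_mul (σ s)] at h1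
    rw [div_eq_inv_mul (τ (t / s))] at h2
    linarith
  · rw [hS.assocFun_mul hT ht, ← sub_le_iff_le_add, ← div_le_iff₀' hC']
    refine le_lowerConj fun s hs => ?_
    rw [div_le_iff₀' hC']
    have hts := div_nonneg ht hs.le
    have h1 := hD s hs.le
    have h2 := hE _ hts
    have h3 := lowerConj_le n1 n2 hs ht
    have h4 : 0 ≤ 2 * j * assocFun (assocMatrix σ ℓ) s := mul_nonneg (by positivity) (m1 s hs.le)
    have h5 : 0 ≤ 2 * ℓ * assocFun (assocMatrix τ j) (t / s) :=
      mul_nonneg (by positivity) (m2 _ hts)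
    linarith

theorem IsWeight.isBigO_of_le {ω ω' : ℝ → ℝ} (h : IsWeight ω) (h' : IsWeight ω') {C D : ℝ}
    (hω : ∀ t, 0 ≤ t → ω t ≤ C * ω' t + D) : ω =O[atTop] ω' := by
  -- The extra `ω'` eventually exceeds `D`.
  refine IsBigO.of_bound (C + 1) ?_
  filter_upwards [eventually_ge_atTop 0, h'.tendsto.eventually_ge_atTop D] with t ht hD
  rw [Real.norm_of_nonneg (h.nonneg ht), Real.norm_of_nonneg (h'.nonneg ht)]
  linarith [hω t ht]

theorem isTheta_assocFun_mul {σ τ : ℝ → ℝ} (hσ : IsWeight σ) (hτ : IsWeight τ) {ℓ j : ℝ}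
    (hℓ : 0 < ℓ) (hj : 0 < j) :
    assocFun (assocMatrix σ ℓ * assocMatrix τ j) =Θ[atTop] lowerConj σ τ := by
  obtain ⟨C, D, C', D', -, -, h1, h2⟩ := exists_assocFun_mul_equiv hσ hτ hℓ hj
  have hw := ((hσ.isWeightSeq_assocMatrix hℓ).mul
    (hτ.isWeightSeq_assocMatrix hj)).isWeight_assocFun
  exact ⟨hw.isBigO_of_le (hσ.lowerConj hτ) h1, (hσ.lowerConj hτ).isBigO_of_le hw h2⟩

/-! ### Transfer along equal spaces and equal rows -/

theorem SameSpaces.symm {ι κ : Type} {a : ι → ℕ → ℝ} {b : κ → ℕ → ℝ} (h : SameSpaces a b) :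
    SameSpaces b a := fun k =>
  let ⟨h1, h2, h3, h4, h5, h6⟩ := h k
  ⟨fun d U => (h1 d U).symm, fun d U => (h2 d U).symm, fun G => (h3 G).symm,
    fun d => (h4 d).symm, h5.symm, fun d c => (h6 d c).symm⟩

theorem SameSpaces.trans {ι κ ν : Type} {a : ι → ℕ → ℝ} {b : κ → ℕ → ℝ} {c : ν → ℕ → ℝ}
    (h : SameSpaces a b) (h' : SameSpaces b c) : SameSpaces a c := fun k =>
  let ⟨h1, h2, h3, h4, h5, h6⟩ := h k
  let ⟨g1, g2, g3, g4, g5, g6⟩ := h' k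
  ⟨fun d U => (h1 d U).trans (g1 d U), fun d U => (h2 d U).trans (g2 d U),
    fun G => (h3 G).trans (g3 G), fun d => (h4 d).trans (g4 d), h5.trans g5,
    fun d c => (h6 d c).trans (g6 d c)⟩

/-- The families `𝓜_σ · 𝓜_τ` and `𝓜_{σ ⌣⋆ τ}` coincide. -/
theorem matFamily_matMul_assocMatrix {σ τ : ℝ → ℝ} (hσ : IsWeight σ) (hτ : IsWeight τ) :
    matFamily (matMul (assocMatrix σ) (assocMatrix τ)) =
      matFamily (assocMatrix (lowerConj σ τ)) := by
  funext i p
  simp only [matFamily, matMul, assocMatrix_lowerConj hσ hτ i.1.2]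

/-- The rows of the product and of the matrix of `σ ⌣⋆ τ` are only known to agree for `ℓ > 0`, so
the matrices cannot be identified outright. -/
theorem ModerateGrowth.congr {M N : ℝ → ℕ → ℝ} (h : ∀ ℓ, 0 < ℓ → M ℓ = N ℓ)
    (hM : ModerateGrowth M) : ModerateGrowth N := fun ℓ hℓ p q => by
  rw [← h ℓ hℓ, ← h (2 * ℓ) (by positivity)]
  exact hM ℓ hℓ p q

theorem ExpAbsorb.congr {M N : ℝ → ℕ → ℝ} (h : ∀ ℓ, 0 < ℓ → M ℓ = N ℓ)
    (hM : ExpAbsorb M) : ExpAbsorb N := fun k hk => by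
  obtain ⟨d, hd, h1⟩ := hM k hk
  refine ⟨d, hd, fun ℓ hℓ => ?_⟩
  rw [← h ℓ hℓ, ← h (d * ℓ) (mul_pos (by linarith) hℓ)]
  exact h1 ℓ hℓ

end BMT

/-! ### Assembly -/

theorem theorem3p2 (σ τ : ℝ → ℝ) (hσ : IsWeight σ) (hτ : IsWeight τ) :
    -- all objects are well defined
    (IsWeight (lowerConj σ τ) ∧
      ∀ ℓ : ℝ, 0 < ℓ → ∀ ℓ₁ : ℝ, 0 < ℓ₁ →
        IsWeight (assocFun (assocMatrix σ ℓ * assocMatrix τ ℓ₁)) ∧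
        ∀ t : ℝ, 0 ≤ t → BddAbove (assocSet (assocMatrix σ ℓ) t) ∧
          BddAbove (assocSet (assocMatrix τ ℓ₁) t) ∧
          BddAbove (assocSet (assocMatrix σ ℓ * assocMatrix τ ℓ₁) t)) ∧
    -- (i)
    (∀ ℓ : ℝ, 0 < ℓ → ∀ ℓ₁ : ℝ, 0 < ℓ₁ →
      (∀ t : ℝ, 0 ≤ t → assocFun (assocMatrix σ ℓ * assocMatrix τ ℓ₁) t =
        lowerConj (assocFun (assocMatrix σ ℓ)) (assocFun (assocMatrix τ ℓ₁)) t) ∧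
      assocFun (assocMatrix σ ℓ * assocMatrix τ ℓ₁) =Θ[atTop] lowerConj σ τ) ∧
    (∀ ℓ : ℝ, 0 < ℓ → ∀ j : ℝ, 0 < j →
      assocFun (assocMatrix σ ℓ * assocMatrix τ ℓ) =Θ[atTop]
        assocFun (assocMatrix σ j * assocMatrix τ j)) ∧
    -- (ii)
    ModerateGrowth (matMul (assocMatrix σ) (assocMatrix τ)) ∧
    -- (iii), (iv), (v)
    (Omega1 σ ∨ Omega1 τ →
      ExpAbsorb (matMul (assocMatrix σ) (assocMatrix τ)) ∧
      (∀ ℓ : ℝ, 0 < ℓ → ∀ j : ℝ, 0 < j →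
        SameSpaces (matFamily (matMul (assocMatrix σ) (assocMatrix τ)))
          (funFamily (assocFun (assocMatrix σ ℓ * assocMatrix τ j))) ∧
        SameSpaces (funFamily (assocFun (assocMatrix σ ℓ * assocMatrix τ j)))
          (funFamily (lowerConj σ τ))) ∧
      (Omega6 τ → ∀ j : ℝ, 0 < j →
        MatEquiv (matMul (assocMatrix σ) (assocMatrix τ))
          (matMulSeq (assocMatrix σ) (assocMatrix τ j)) ∧
        SameSpaces (matFamily (matMul (assocMatrix σ) (assocMatrix τ)))
          (matFamily (matMulSeq (assocMatrix σ) (assocMatrix τ j)))) ∧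
      (Omega6 σ → ∀ ℓ : ℝ, 0 < ℓ →
        MatEquiv (matMul (assocMatrix σ) (assocMatrix τ))
          (seqMulMat (assocMatrix σ ℓ) (assocMatrix τ)) ∧
        SameSpaces (matFamily (matMul (assocMatrix σ) (assocMatrix τ)))
          (matFamily (seqMulMat (assocMatrix σ ℓ) (assocMatrix τ))))) := by
  have hw := hσ.lowerConj hτ
  have hrow : ∀ ℓ, 0 < ℓ →
      assocMatrix (lowerConj σ τ) ℓ = matMul (assocMatrix σ) (assocMatrix τ) ℓ := fun ℓ hℓ =>
    assocMatrix_lowerConj hσ hτ hℓ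
  have hS := fun ℓ (hℓ : 0 < ℓ) => hσ.isWeightSeq_assocMatrix hℓ
  have hT := fun ℓ (hℓ : 0 < ℓ) => hτ.isWeightSeq_assocMatrix hℓ
  have pos : ∀ ℓ j p, 0 < (assocMatrix σ ℓ * assocMatrix τ j) p := fun ℓ j p =>
    mul_pos (assocMatrix_pos _ _ _) (assocMatrix_pos _ _ _)
  refine ⟨⟨hw, fun ℓ hℓ j hj => ⟨((hS ℓ hℓ).mul (hT j hj)).isWeight_assocFun, fun t ht =>
      ⟨(hS ℓ hℓ).bddAbove_assocSet ht, (hT j hj).bddAbove_assocSet ht,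
        ((hS ℓ hℓ).mul (hT j hj)).bddAbove_assocSet ht⟩⟩⟩,
    fun ℓ hℓ j hj => ⟨fun t ht => (hS ℓ hℓ).assocFun_mul (hT j hj) ht,
      isTheta_assocFun_mul hσ hτ hℓ hj⟩,
    fun ℓ hℓ j hj => (isTheta_assocFun_mul hσ hτ hℓ hℓ).trans
      (isTheta_assocFun_mul hσ hτ hj hj).symm,
    hw.moderateGrowth.congr hrow, fun h1 => ?_⟩
  have hw1 := omega1_lowerConj hσ hτ h1
  refine ⟨(hw.expAbsorb hw1).congr hrow, fun ℓ hℓ j hj => ?_, fun h6 j hj => ?_, fun h6 ℓ hℓ => ?_⟩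
  · obtain ⟨C, D, C', D', hC, hC', h2, h3⟩ := exists_assocFun_mul_equiv hσ hτ hℓ hj
    have e1 := sameSpaces_funFamily ((hS ℓ hℓ).mul (hT j hj)).isWeight_assocFun hw hC hC' h2 h3
    have e2 := sameSpaces_matFamily_funFamily hw hw1
    rw [← matFamily_matMul_assocMatrix hσ hτ] at e2
    exact ⟨e2.trans e1.symm, e1⟩
  -- Under `(ω₆)` each row `T^(ℓ)` is equivalent to the fixed `T^(j)`, and multiplication by `S^(ℓ)`
  -- preserves this.
  · exact matEquiv_and_sameSpaces (fun ℓ => pos ℓ ℓ) (fun ℓ => pos ℓ j)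
      (fun ℓ hℓ => (hτ.seqDomExp_of_omega6 h6 hℓ hj).mul_left (assocMatrix_pos σ ℓ))
      (fun ℓ hℓ => (hτ.seqDomExp_of_omega6 h6 hj hℓ).mul_left (assocMatrix_pos σ ℓ))
  · refine matEquiv_and_sameSpaces (fun ℓ => pos ℓ ℓ) (fun j => pos ℓ j) (fun j hj => ?_)
      (fun j hj => ?_)
    · have := (hσ.seqDomExp_of_omega6 h6 hj hℓ).mul_left (assocMatrix_pos τ j)
      rwa [mul_comm, mul_comm (assocMatrix τ j)] at this
    · have := (hσ.seqDomExp_of_omega6 h6 hℓ hj).mul_left (assocMatrix_pos τ j)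
      rwa [mul_comm, mul_comm (assocMatrix τ j)] at this
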